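/- Let $n\ge 0$ and $k\ge1$ be integers and $[k]=\{1,\dots,k\}$. A pairwise graphical model $\mathcal D(\mathcal W,\Theta)$ is given by matrices $W_{ij}\in\mathbb R^{k\times k}$ ($i\ne j\in[n]$) with $W_{ij}=W_{ji}^T$ whose rows and columns all sum to zero, and vectors $\theta_i\in\mathbb R^k$ ($i\in[n]$); it is the distribution on $[k]^n$ with $$\Pr[Z=z]\propto \exp\Big(\sum_{1\le i<j\le n}W_{ij}(z_i,z_j)+\sum_{i\in[n]}\theta_i(z_i)\Big).$$ Its width is $\lambda(\mathcal W,\Theta)=\max_{i,a}\big(\sum_{j\ne i}\max_{b}|W_{ij}(a,b)|+|\theta_i(a)|\big)$ (read as $0$ if $n=0$). For a matrix $w$ write $\|w\|_{2,1}=\sum_j\|w(j,:)\|_2$. Algorithm (input: samples $z^1,\dots,z^N\in[k]^n$ and a number $\lambda\ge0$). For every $i\in[n]$ and every ordered pair $\alpha\ne\beta$ in $[k]$: 1. Let $S$ be the collection of the samples $z^m$ (with repetitions) such that $z^m_i\in\{\alpha,\beta\}$. To each $z^t\in S$ attach $y^t=1$ if $z^t_i=\alpha$ and $y^t=-1$ if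 $z^t_i=\beta$, and the matrix $x^t\in\{0,1\}^{n\times k}$ that consists of the rows $e_{z^t_j}$ for $j\neq i$ and one further row $e_1$ (the one-hot encoding of $[z^t_{-i},1]$); the rows of $n\times k$ matrices are labelled by the variables $j\ne i$ and by "const" for the further row. 2. Let $w^{\alpha,\beta}\in\mathbb R^{n\times k}$ be any minimizer of $\frac1{|S|}\sum_{t\in S}\ln\big(1+e^{-y^t\langle w,x^t\rangle}\big)$ subject to $\|w\|_{2,1}\le 2\lambda\sqrt k$ (if $S=\emptyset$, any feasible point). 3. Put $U^{\alpha,\beta}(j,b)=w^{\alpha,\beta}(j,b)-\frac1k\sum_a w^{\alpha,\beta}(j,a)$ for $j\ne i$, and $U^{\alpha,\beta}(\mathrm{const},b)=w^{\alpha,\beta}(\mathrm{const},b)+\frac1k\sum_{j\ne i}\sum_a w^{\alpha,\beta}(j,a)$. Then, with $U^{\alpha,\alpha}=0$, output $\hat W_{ij}(\alpha,b)=\frac1k\sum_{\beta\in[k]}U^{\alpha,\beta}(j,b)$ for all $i\ne j$ and all $\alpha,b\in[k]$, where $U^{\alpha,\beta}$ is the matrix computed for the variable $i$. Theorem. There is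 a universal constant $C>0$ such that the following holds for all $n$ and $k$, all $\rho\in(0,1)$ and $\epsilon>0$, all $\lambda$, and every pairwise graphical model $\mathcal D(\mathcal W,\Theta)$ with $\lambda(\mathcal W,\Theta)\le\lambda$. If $z^1,\dots,z^N$ are i.i.d. samples from $\mathcal D(\mathcal W,\Theta)$ with $$N\ge C\,\frac{\lambda^2k^4e^{14\lambda}\ln(nk/\rho)}{\epsilon^4}$$ (for $n=0$ the right-hand side is read as $0$), then with probability at least $1-\rho$ the minimizers in step 2 exist and, for every choice of them, the output of the algorithm satisfies $$|W_{ij}(a,b)-\hat W_{ij}(a,b)|\le\epsilon\qquad\text{for all } i\ne j\in[n]\text{ and all } a,b\in[k].$$ -/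

import Mathlib

open MeasureTheory ProbabilityTheory

/-- The parameters of an `n`-variable pairwise graphical model over the alphabet `[k] = Fin k`:
weight matrices `W i j` for `i ≠ j`, with `W j i = (W i j)ᵀ` and centered rows and columns, and
external fields `θ i`. The diagonal entries `W i i` carry no information and are never used. -/
structure PairwiseModel (n k : ℕ) where
  /-- the weight matrices -/
  W : Fin n → Fin n → Matrix (Fin k) (Fin k) ℝ
  /-- the external field vectors -/
  θ : Fin n → Fin k → ℝ
  symm : ∀ i j, i ≠ j → W j i = (W i j).transpose
  row_centered : ∀ i j, i ≠ j → ∀ a, ∑ b, W i j a b = 0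
  col_centered : ∀ i j, i ≠ j → ∀ b, ∑ a, W i j a b = 0

namespace PairwiseModel

variable {n k : ℕ}

/-- The exponent `∑_{i<j} W_{ij}(z_i, z_j) + ∑_i θ_i(z_i)`. -/
noncomputable def exponent (M : PairwiseModel n k) (z : Fin n → Fin k) : ℝ :=
  (∑ i, ∑ j ∈ Finset.univ.filter (fun j => i < j), M.W i j (z i) (z j)) + ∑ i, M.θ i (z i)

/-- The normalizing constant. -/
noncomputable def partition (M : PairwiseModel n k) : ℝ :=
  ∑ z : Fin n → Fin k, Real.exp (M.exponent z)

/-- The distribution `𝒟(𝒲, Θ)` on `[k]^n`: the point `z` has mass proportional to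
`exp (M.exponent z)`. -/
noncomputable def dist (M : PairwiseModel n k) : Measure (Fin n → Fin k) :=
  ∑ z : Fin n → Fin k,
    ENNReal.ofReal (Real.exp (M.exponent z) / M.partition) • Measure.dirac z

/-- The width `max_{i,a} (∑_{j ≠ i} max_b |W_{ij}(a,b)| + |θ_i(a)|)`. -/
noncomputable def width (M : PairwiseModel n k) : ℝ :=
  ⨆ i : Fin n, ⨆ a : Fin k,
    (∑ j ∈ Finset.univ.filter (fun j => j ≠ i), ⨆ b : Fin k, |M.W i j a b|) + |M.θ i a|

end PairwiseModel

namespace PairwiseLearning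

variable {n k N : ℕ}

/-- One-hot encoding `[k]^n → {0,1}^{n × k}`. -/
def oneHot (z : Fin n → Fin k) : Matrix (Fin n) (Fin k) ℝ :=
  Matrix.of fun j b => if z j = b then 1 else 0

/-- The covariate attached to a sample `z` when variable `i` is regressed on the others: the
one-hot encoding of `z_{-i}` together with one constant coordinate (equal to the first symbol).
The constant coordinate is kept in the vacant row `i`, so that row `j ≠ i` belongs to the
variable `j` and no renumbering of the rows is needed. -/
def covariate [NeZero k] (i : Fin n) (z : Fin n → Fin k) : Matrix (Fin n) (Fin k) ℝ :=
  oneHot (Function.update z i 0)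

/-- The label of a sample with `z_i ∈ {α, β}`: `1` if `z_i = α` and `-1` if `z_i = β`. -/
def label (i : Fin n) (α : Fin k) (z : Fin n → Fin k) : ℝ :=
  if z i = α then 1 else -1

/-- The (indices of the) samples whose `i`-th variable is `α` or `β`. -/
def selected (z : Fin N → Fin n → Fin k) (i : Fin n) (α β : Fin k) : Finset (Fin N) :=
  Finset.univ.filter fun m => z m i = α ∨ z m i = β

/-- The entrywise inner product of two matrices. -/
def matInner (w x : Matrix (Fin n) (Fin k) ℝ) : ℝ :=
  ∑ j, ∑ b, w j b * x j b

/-- The norm `‖w‖_{2,1} = ∑_j ‖w(j,:)‖_2`. -/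
noncomputable def norm21 (w : Matrix (Fin n) (Fin k) ℝ) : ℝ :=
  ∑ j, Real.sqrt (∑ b, w j b ^ 2)

/-- The empirical logistic loss `|S|⁻¹ ∑_{t ∈ S} ln (1 + exp (-y^t ⟨w, x^t⟩))` over the samples
whose `i`-th variable is `α` or `β` (equal to `0` if there is no such sample, in which case every
feasible point is a minimizer). -/
noncomputable def empLoss [NeZero k] (z : Fin N → Fin n → Fin k) (i : Fin n) (α β : Fin k)
    (w : Matrix (Fin n) (Fin k) ℝ) : ℝ :=
  (1 / ((selected z i α β).card : ℝ)) *
    ∑ t ∈ selected z i α β,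
      Real.log (1 + Real.exp (-(label i α (z t) * matInner w (covariate i (z t)))))

/-- The feasible set `‖w‖_{2,1} ≤ 2 λ √k`. -/
def feasible (n k : ℕ) (lam : ℝ) : Set (Matrix (Fin n) (Fin k) ℝ) :=
  {w | norm21 w ≤ 2 * lam * Real.sqrt k}

/-- `w` is a minimizer of the `ℓ_{2,1}`-constrained logistic regression for `(i, α, β)`. -/
def IsRegressionMinimizer [NeZero k] (lam : ℝ) (z : Fin N → Fin n → Fin k) (i : Fin n)
    (α β : Fin k) (w : Matrix (Fin n) (Fin k) ℝ) : Prop :=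
  w ∈ feasible n k lam ∧ IsMinOn (empLoss z i α β) (feasible n k lam) w

/-- Centering of all rows but the one (row `i`) of the constant coordinate, whose entries absorb
the subtracted means. -/
noncomputable def center (i : Fin n) (w : Matrix (Fin n) (Fin k) ℝ) :
    Matrix (Fin n) (Fin k) ℝ :=
  Matrix.of fun j b =>
    if j = i then
      w i b + (1 / (k : ℝ)) * ∑ l ∈ Finset.univ.filter (fun l => l ≠ i), ∑ a, w l a
    else
      w j b - (1 / (k : ℝ)) * ∑ a, w j a

/-- `What` is a possible family of weight estimates produced, with bound `lam` on the width, by the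
algorithm on the samples `z`: for every variable `i` and every pair `α ≠ β` pick any minimizer of
the constrained logistic regression, center it to `U^{α,β}` (with `U^{α,α} = 0`), and set
`Ŵ_{ij}(α,:) = (1/k) ∑_β U^{α,β}(j,:)` for `j ≠ i`. -/
def IsOutput [NeZero k] (lam : ℝ) (z : Fin N → Fin n → Fin k)
    (What : Fin n → Fin n → Matrix (Fin k) (Fin k) ℝ) : Prop :=
  ∃ w : Fin n → Fin k → Fin k → Matrix (Fin n) (Fin k) ℝ,
    (∀ i α β, α ≠ β → IsRegressionMinimizer lam z i α β (w i α β)) ∧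
    ∀ i j, j ≠ i → ∀ α b,
      What i j α b =
        (1 / (k : ℝ)) * ∑ β, (if α = β then 0 else center i (w i α β) j b)

end PairwiseLearning

/-! Fix `i` and `α ≠ β`, let `S` be the event `z i ∈ {α, β}`, and write `Λ = e^λ`, `L = ln(nk/ρ)`.
Given `S` and the other variables, the label of `z i` is logistic with logit `⟨w*, x⟩`, where `w*`
is `trueWeights`, a feasible point. Hence the excess logistic risk `E` of any `w` is the mean over
`S` of the Bregman divergence of `ln(1 + e^x)` between the true and the fitted predictor
(`sum_pair_excess'`).

Statistics. Symmetrization, contraction and the Hilbert space bound `E cosh ‖∑ ± x_t‖ ≤ ∏ cosh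
‖x_t‖` control the uniform deviation over the `ℓ_{2,1}` ball, at the price of a factor `2n` only
(`uniform_deviation`). On an event of probability `q` the deviation is `δ √q` with `δ` of order `λ
√k √(L/N)`. This is used for `S` and for its intersection with `z j = b`.

Small errors. Local fields lie in `[-λ, λ]`, so changing one variable changes the mass by a factor
at most `Λ²`. Moving `z j` between two symbols shifts the predictor error by a difference of two
entries of row `j` of `w - w*`. A centered error `T` therefore forces `E ≳ min(T, T²) P(S) / (k Λ⁴)`
(`sum_mass_mul_min_le`). Together with `E ≤ δ √P(S)` and `P(S) ≥ 1/(k Λ²)` this excludes `T > ε`,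
unless the minimum is linear and `ε > 500 Λ²` (`error_large_of_risk_le`).

Large errors. Row means of feasible matrices are at most `2λ`, so a huge `T` means a huge entry `w j
b`. Lowering it by `T/4` affects only samples with `z j = b` and helps those with label `β`, unless
the rest of the predictor is below `-T/8` with noticeable probability; optimality of `w` forces the
latter (`local_risk_ge`). Then, on average over `z j`, the predictor is very negative, which costs
excess risk linear in `T` without losing a factor `k` (`excess_ge_of_rest`). The constraint `T ≤
6λ√k` now gives a contradiction (`error_le_of_large`). A union bound over all `i, α, β, j, b`
concludes. -/

/-! ### Majorization inequalities and the hyperbolic cosine of a norm -/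

section Majorization

/-- Weak majorization of pairs is respected by the exponential function. -/
theorem exp_add_exp_le_of_majorized {x₁ x₂ y₁ y₂ : ℝ} (hs : x₁ + x₂ ≤ y₁ + y₂)
    (hm : max x₁ x₂ ≤ max y₁ y₂) :
    Real.exp x₁ + Real.exp x₂ ≤ Real.exp y₁ + Real.exp y₂ := by
  wlog hx : x₂ ≤ x₁ generalizing x₁ x₂
  · have := this (x₁ := x₂) (x₂ := x₁) (by linarith) (by rwa [max_comm]) (by linarith)
    linarith
  wlog hy : y₂ ≤ y₁ generalizing y₁ y₂
  · have := this (y₁ := y₂) (y₂ := y₁) (by linarith) (by rwa [max_comm y₂ y₁]) (by linarith)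
    linarith
  rw [max_eq_left hx, max_eq_left hy] at hm
  rcases lt_or_ge x₁ y₂ with h | h
  · have h1 := Real.exp_le_exp.2 hm
    have h2 := Real.exp_le_exp.2 (hx.trans h.le)
    linarith
  · have h1 := Real.exp_le_exp.2 hm
    have h2 := Real.exp_le_exp.2 h
    have h3 : Real.exp x₂ ≤ Real.exp (y₁ + y₂ - x₁) := Real.exp_le_exp.2 (by linarith)
    have h4 : Real.exp (y₁ + y₂ - x₁) * Real.exp x₁ = Real.exp y₁ * Real.exp y₂ := by
      rw [← Real.exp_add, ← Real.exp_add]; congr 1; ring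
    have h5 := Real.exp_pos x₁
    nlinarith [mul_nonneg (sub_nonneg.2 h1) (sub_nonneg.2 h2)]

/-- Majorization of pairs is respected by powers on the nonnegative half-line. -/
theorem pow_add_pow_le_of_majorized {a b c d : ℝ} (hd : 0 ≤ d) (hbd : d ≤ b) (hab : b ≤ a)
    (hs : a + b = c + d) (n : ℕ) : a ^ n + b ^ n ≤ c ^ n + d ^ n := by
  rcases (show d ≤ c by linarith).eq_or_lt with h | h
  · have h1 : a = d := by linarith
    have h2 : b = d := by linarith
    rw [h1, h2, h]
  · have hcd : 0 < c - d := by linarith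
    have key := fun θ (h0 : 0 ≤ θ) (h1 : 0 ≤ 1 - θ) =>
      (convexOn_pow n).2 (x := c) (y := d) (by simp; linarith) (by simpa) h0 h1 (by ring)
    have k1 := key ((a - d) / (c - d)) (by apply div_nonneg <;> linarith)
      (by rw [sub_nonneg, div_le_one hcd]; linarith)
    have k2 := key (1 - (a - d) / (c - d)) (by rw [sub_nonneg, div_le_one hcd]; linarith)
      (by simpa using div_nonneg (by linarith : 0 ≤ a - d) hcd.le)
    simp only [smul_eq_mul] at k1 k2
    have e1 : (a - d) / (c - d) * c + (1 - (a - d) / (c - d)) * d = a := by field_simp; ring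
    have e2 : (1 - (a - d) / (c - d)) * c + (1 - (1 - (a - d) / (c - d))) * d = b := by
      field_simp
      rw [show b = c + d - a by linarith]; ring
    rw [e1] at k1
    rw [e2] at k2
    linarith

variable {E : Type*} [NormedAddCommGroup E] [InnerProductSpace ℝ E]

/-- By the parallelogram law `‖u ± x‖²` have the same sum as `(‖u‖ ± ‖x‖)²`, and by Cauchy-Schwarz
they lie between them. Thus one pair majorizes the other, and the even power series of `cosh` is
compared term by term. -/
theorem cosh_norm_add_add_cosh_norm_sub_le (u x : E) :
    Real.cosh ‖u + x‖ + Real.cosh ‖u - x‖ ≤ 2 * (Real.cosh ‖u‖ * Real.cosh ‖x‖) := by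
  have e : 2 * (Real.cosh ‖u‖ * Real.cosh ‖x‖)
      = Real.cosh (‖u‖ + ‖x‖) + Real.cosh (‖u‖ - ‖x‖) := by
    rw [Real.cosh_add, Real.cosh_sub]; ring
  rw [e]
  refine hasSum_le (fun n => ?_) ((Real.hasSum_cosh _).add (Real.hasSum_cosh _))
    ((Real.hasSum_cosh _).add (Real.hasSum_cosh _))
  rw [← add_div, ← add_div]
  apply div_le_div_of_nonneg_right _ (by positivity)
  simp only [pow_mul]
  have hi := abs_le.1 (abs_real_inner_le_norm u x)
  have h1 := norm_add_sq_real u x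
  have h2 := norm_sub_sq_real u x
  rcases le_total 0 (inner ℝ u x) with h | h
  · apply pow_add_pow_le_of_majorized (by positivity) <;> nlinarith
  · rw [add_comm ((‖u + x‖ ^ 2) ^ n)]
    apply pow_add_pow_le_of_majorized (by positivity) <;> nlinarith

end Majorization

/-! ### Rademacher sums: norms and contraction -/

section Rademacher

/-- The sign `±1` encoded by a Boolean. -/
def boolSign (s : Bool) : ℝ := if s then 1 else -1

theorem sum_bool_cons {N : ℕ} (f : (Fin (N + 1) → Bool) → ℝ) :
    ∑ s, f s = ∑ s : Fin N → Bool, (f (Fin.cons true s) + f (Fin.cons false s)) := by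
  rw [← (Fin.consEquiv (fun _ => Bool)).sum_comp f, Fintype.sum_prod_type, Fintype.sum_bool,
    ← Finset.sum_add_distrib]
  rfl

variable {E : Type*} [NormedAddCommGroup E] [InnerProductSpace ℝ E]

/-- Signs are averaged out one at a time. The bound is that of scalar Rademacher sums, free of the
dimension of `E`. -/
theorem sum_cosh_norm_rademacher_le {N : ℕ} (x : Fin N → E) :
    ∑ s : Fin N → Bool, Real.cosh ‖∑ t, boolSign (s t) • x t‖
      ≤ 2 ^ N * ∏ t, Real.cosh ‖x t‖ := by
  induction N with
  | zero => simp
  | succ N ih =>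
    rw [sum_bool_cons]
    simp only [Fin.sum_univ_succ, Fin.cons_zero, Fin.cons_succ, boolSign]
    calc _ ≤ ∑ s : Fin N → Bool,
          2 * Real.cosh ‖x 0‖ * Real.cosh ‖∑ t, boolSign (s t) • x t.succ‖ := by
          refine Finset.sum_le_sum fun s _ => ?_
          have := cosh_norm_add_add_cosh_norm_sub_le (∑ t, boolSign (s t) • x t.succ) (x 0)
          simp only [if_true, one_smul, Bool.false_eq_true, if_false, neg_smul]
          rw [add_comm (x 0), add_comm (-x 0), ← sub_eq_add_neg]
          refine this.trans (le_of_eq (by ring))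
      _ ≤ 2 * Real.cosh ‖x 0‖ * (2 ^ N * ∏ t, Real.cosh ‖x (Fin.succ t)‖) := by
          rw [← Finset.mul_sum]
          exact mul_le_mul_of_nonneg_left (ih _) (by have := Real.cosh_pos ‖x 0‖; positivity)
      _ = _ := by rw [Fin.prod_univ_succ]; ring

variable {ι : Type*} [Finite ι] [Nonempty ι]

/-- The two suprema on the left are weakly majorized by those on the right. At maximizers `i`, `j`
the sum is controlled by the Lipschitz hypothesis `h`, the maximum by `h0`. -/
theorem exp_iSup_contraction_step (A f u : ι → ℝ) (h0 : ∀ i, |f i| ≤ |u i|)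
    (h : ∀ i j, |f i - f j| ≤ |u i - u j|) :
    Real.exp (⨆ i, (A i + f i)) + Real.exp (⨆ i, (A i - f i))
      ≤ Real.exp (⨆ i, (A i + u i)) + Real.exp (⨆ i, (A i - u i)) := by
  obtain ⟨i, hi⟩ := exists_eq_ciSup_of_finite (f := fun i => A i + f i)
  obtain ⟨j, hj⟩ := exists_eq_ciSup_of_finite (f := fun i => A i - f i)
  have hP : ∀ l, A l + u l ≤ ⨆ i, (A i + u i) :=
    fun l => le_ciSup (f := fun i => A i + u i) (Set.finite_range _).bddAbove l
  have hQ : ∀ l, A l - u l ≤ ⨆ i, (A i - u i) :=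
    fun l => le_ciSup (f := fun i => A i - u i) (Set.finite_range _).bddAbove l
  rw [← hi, ← hj]
  apply exp_add_exp_le_of_majorized
  · have := le_abs_self (f i - f j)
    have := h i j
    rcases abs_cases (u i - u j) with ⟨h1, _⟩ | ⟨h1, _⟩
    · linarith [hP i, hQ j]
    · linarith [hP j, hQ i]
  · have hmax : ∀ l, A l + |u l| ≤ max (⨆ i, (A i + u i)) (⨆ i, (A i - u i)) := fun l => by
      rcases abs_cases (u l) with ⟨h1, _⟩ | ⟨h1, _⟩ <;> rw [h1]
      · exact (hP l).trans (le_max_left _ _)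
      · exact (le_of_eq (by ring)).trans ((hQ l).trans (le_max_right _ _))
    apply max_le
    · linarith [hmax i, h0 i, le_abs_self (f i)]
    · linarith [hmax j, h0 j, neg_abs_le (f j)]

/-- A contraction principle for exponential moments. The offset `A` is arbitrary so that, in the
induction, it absorbs the coordinate already replaced. -/
theorem sum_exp_iSup_contraction {N : ℕ} (A : ι → ℝ) (f u : Fin N → ι → ℝ)
    (h0 : ∀ t i, |f t i| ≤ |u t i|) (h : ∀ t i j, |f t i - f t j| ≤ |u t i - u t j|) :
    ∑ s : Fin N → Bool, Real.exp (⨆ i, (A i + ∑ t, boolSign (s t) * f t i))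
      ≤ ∑ s : Fin N → Bool, Real.exp (⨆ i, (A i + ∑ t, boolSign (s t) * u t i)) := by
  induction N generalizing A with
  | zero => simp
  | succ N ih =>
    rw [sum_bool_cons, sum_bool_cons]
    simp only [Fin.sum_univ_succ, Fin.cons_zero, Fin.cons_succ, boolSign, if_true,
      Bool.false_eq_true, if_false, one_mul, neg_mul]
    calc _ ≤ ∑ s : Fin N → Bool,
          (Real.exp (⨆ i, ((A i + u 0 i) + ∑ t, boolSign (s t) * f (Fin.succ t) i))
          + Real.exp (⨆ i, ((A i - u 0 i) + ∑ t, boolSign (s t) * f (Fin.succ t) i))) := by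
          refine Finset.sum_le_sum fun s _ => ?_
          have := exp_iSup_contraction_step
            (fun i => A i + ∑ t, boolSign (s t) * f (Fin.succ t) i) (f 0) (u 0) (h0 0) (h 0)
          convert this using 5 <;> (try simp only [boolSign]) <;> first | ring | rfl
      _ ≤ _ := by
          rw [Finset.sum_add_distrib, Finset.sum_add_distrib]
          have h1 := ih (fun i => A i + u 0 i) (fun t => f t.succ) (fun t => u t.succ)
            (fun t => h0 _) (fun t => h _)
          have h2 := ih (fun i => A i - u 0 i) (fun t => f t.succ) (fun t => u t.succ)
            (fun t => h0 _) (fun t => h _)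
          simp only [boolSign, sub_eq_add_neg, add_assoc] at h1 h2 ⊢
          exact add_le_add h1 h2

end Rademacher

/-! ### Symmetrization for i.i.d. samples from a finite space -/

section FiniteProduct

variable {X : Type*} [Fintype X] {N : ℕ} {μ : X → ℝ}

theorem sum_prod_mul_prod [DecidableEq X] (f : X → ℝ) :
    ∑ z : Fin N → X, (∏ t, μ (z t)) * ∏ t, f (z t) = (∑ x, μ x * f x) ^ N := by
  have := Finset.prod_univ_sum (fun _ : Fin N => (Finset.univ : Finset X)) (fun _ x => μ x * f x)
  simp only [Finset.prod_const, Finset.card_univ, Fintype.card_fin, Fintype.piFinset_univ] at this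
  rw [this]
  exact Finset.sum_congr rfl fun z _ => Finset.prod_mul_distrib.symm

theorem sum_prod_eq_one [DecidableEq X] (h1 : ∑ x, μ x = 1) :
    ∑ z : Fin N → X, ∏ t, μ (z t) = 1 := by
  simpa [h1] using sum_prod_mul_prod (N := N) (μ := μ) fun _ => 1

theorem sum_prod_mul_apply [DecidableEq X] (h1 : ∑ x, μ x = 1) (f : X → ℝ) (t : Fin N) :
    ∑ z : Fin N → X, (∏ m, μ (z m)) * f (z t) = ∑ x, μ x * f x := by
  have := Finset.prod_univ_sum (fun _ : Fin N => (Finset.univ : Finset X))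
    (fun m x => μ x * if m = t then f x else 1)
  simp only [Fintype.piFinset_univ, Finset.prod_mul_distrib] at this
  rw [Finset.prod_eq_single t (fun m _ hm => by simp [hm, h1]) (by simp)] at this
  simp only [if_true] at this
  rw [this]
  refine Finset.sum_congr rfl fun z _ => ?_
  simp

/-- Exchange the `t`-th entries of two samples whenever `s t` is false. -/
def swapSamples (s : Fin N → Bool) (p : (Fin N → X) × (Fin N → X)) :
    (Fin N → X) × (Fin N → X) :=
  (fun t => if s t then p.1 t else p.2 t, fun t => if s t then p.2 t else p.1 t)

theorem swapSamples_involutive (s : Fin N → Bool) :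
    Function.Involutive (swapSamples (X := X) s) := by
  rintro ⟨a, b⟩
  ext t <;> by_cases h : s t <;> simp [swapSamples, h]

variable {ι : Type*} [Finite ι] [Nonempty ι]

/-- Exchanging the `t`-th entries of the sample and of its independent copy preserves the product
weight and flips the sign of the `t`-th difference. -/
theorem sum_sum_exp_iSup_sub_eq (F : ι → X → ℝ) (s : Fin N → Bool) :
    ∑ z : Fin N → X, ∑ z' : Fin N → X, (∏ t, μ (z t)) * (∏ t, μ (z' t)) *
        Real.exp (⨆ i, ∑ t, (F i (z' t) - F i (z t)))
      = ∑ z : Fin N → X, ∑ z' : Fin N → X, (∏ t, μ (z t)) * (∏ t, μ (z' t)) *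
        Real.exp (⨆ i, ∑ t, boolSign (s t) * (F i (z' t) - F i (z t))) := by
  rw [← Fintype.sum_prod_type', ← Fintype.sum_prod_type',
    ← Equiv.sum_comp ((swapSamples_involutive (X := X) s).toPerm _)]
  refine Finset.sum_congr rfl fun p _ => ?_
  simp only [Function.Involutive.coe_toPerm, swapSamples, ← Finset.prod_mul_distrib]
  congr 1
  · refine Finset.prod_congr rfl fun t _ => ?_
    by_cases h : s t <;> simp [h, mul_comm]
  · congr 2
    ext i
    refine Finset.sum_congr rfl fun t _ => ?_
    by_cases h : s t <;> simp [h, boolSign]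

theorem sum_bool_not (f : (Fin N → Bool) → ℝ) :
    ∑ s : Fin N → Bool, f (fun t => !s t) = ∑ s, f s := by
  have hinv : Function.Involutive (fun (s : Fin N → Bool) t => !s t) := fun s => by ext; simp
  exact Equiv.sum_comp (hinv.toPerm _) f

/-- Symmetrization of the exponential moment of a supremum of centered empirical sums. -/
theorem exp_moment_symmetrization [DecidableEq X] (h0 : ∀ x, 0 ≤ μ x) (h1 : ∑ x, μ x = 1)
    (F : ι → X → ℝ) :
    ∑ z : Fin N → X, (∏ t, μ (z t)) *
        Real.exp (⨆ i, ∑ t, ((∑ x, μ x * F i x) - F i (z t)))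
      ≤ (2 ^ N)⁻¹ * ∑ z : Fin N → X, (∏ t, μ (z t)) *
        ∑ s : Fin N → Bool, Real.exp (⨆ i, ∑ t, boolSign (s t) * (2 * F i (z t))) := by
  have hp : ∀ z : Fin N → X, 0 ≤ ∏ t, μ (z t) := fun z => Finset.prod_nonneg fun t _ => h0 _
  have hb : ∀ f : ι → ℝ, BddAbove (Set.range f) := fun f => (Set.finite_range f).bddAbove
  -- The mean is an average over an independent copy `z'` of the sample; the average leaves the
  -- supremum, and then the exponential by Jensen.
  have step1 : ∀ z : Fin N → X,
      Real.exp (⨆ i, ∑ t, ((∑ x, μ x * F i x) - F i (z t))) ≤ ∑ z' : Fin N → X,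
        (∏ t, μ (z' t)) * Real.exp (⨆ i, ∑ t, (F i (z' t) - F i (z t))) := fun z => by
    have e : ∀ i, ∑ t, ((∑ x, μ x * F i x) - F i (z t))
        = ∑ z' : Fin N → X, (∏ t, μ (z' t)) * ∑ t, (F i (z' t) - F i (z t)) := fun i => by
      simp only [Finset.mul_sum]
      rw [Finset.sum_comm]
      refine Finset.sum_congr rfl fun t _ => ?_
      simp only [mul_sub, Finset.sum_sub_distrib, ← Finset.sum_mul]
      rw [sum_prod_mul_apply h1, sum_prod_eq_one h1, one_mul]
    have h2 : (⨆ i, ∑ t, ((∑ x, μ x * F i x) - F i (z t))) ≤ ∑ z' : Fin N → X,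
        (∏ t, μ (z' t)) * ⨆ i, ∑ t, (F i (z' t) - F i (z t)) := by
      refine ciSup_le fun i => ?_
      rw [e]
      exact Finset.sum_le_sum fun z' _ => mul_le_mul_of_nonneg_left
        (le_ciSup (hb fun i => ∑ t, (F i (z' t) - F i (z t))) i) (hp z')
    refine (Real.exp_le_exp.2 h2).trans ?_
    exact convexOn_exp.map_sum_le (fun z' _ => hp z') (sum_prod_eq_one h1) (by simp)
  have step2 : ∀ s : Fin N → Bool, ∑ z : Fin N → X, (∏ t, μ (z t)) *
        Real.exp (⨆ i, ∑ t, ((∑ x, μ x * F i x) - F i (z t)))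
      ≤ ∑ z : Fin N → X, (∏ t, μ (z t)) *
        ((Real.exp (⨆ i, ∑ t, boolSign (s t) * (2 * F i (z t)))
          + Real.exp (⨆ i, ∑ t, boolSign (!s t) * (2 * F i (z t)))) / 2) := fun s => by
    calc _ ≤ ∑ z : Fin N → X, ∑ z' : Fin N → X, (∏ t, μ (z t)) * (∏ t, μ (z' t)) *
          Real.exp (⨆ i, ∑ t, (F i (z' t) - F i (z t))) := by
          refine Finset.sum_le_sum fun z _ => ?_
          refine (mul_le_mul_of_nonneg_left (step1 z) (hp z)).trans (le_of_eq ?_)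
          rw [Finset.mul_sum]
          exact Finset.sum_congr rfl fun z' _ => by ring
      _ = _ := sum_sum_exp_iSup_sub_eq F s
      _ ≤ ∑ z : Fin N → X, ∑ z' : Fin N → X, (∏ t, μ (z t)) * (∏ t, μ (z' t)) *
          ((Real.exp (⨆ i, ∑ t, boolSign (s t) * (2 * F i (z' t)))
          + Real.exp (⨆ i, ∑ t, boolSign (!s t) * (2 * F i (z t)))) / 2) := by
          refine Finset.sum_le_sum fun z _ => Finset.sum_le_sum fun z' _ => ?_
          refine mul_le_mul_of_nonneg_left ?_ (mul_nonneg (hp _) (hp _))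
          set A := ⨆ i, ∑ t, boolSign (s t) * (2 * F i (z' t))
          set B := ⨆ i, ∑ t, boolSign (!s t) * (2 * F i (z t))
          -- The two samples are separated by subadditivity of the supremum, and `e^{A/2 + B/2} ≤
          -- (e^A + e^B)/2` then decouples them. This is where `F` becomes `2 F`.
          have hAB : (⨆ i, ∑ t, boolSign (s t) * (F i (z' t) - F i (z t))) ≤ A / 2 + B / 2 := by
            refine ciSup_le fun i => ?_
            have hA : _ ≤ A :=
              le_ciSup (hb fun i => ∑ t, boolSign (s t) * (2 * F i (z' t))) i
            have hB : _ ≤ B :=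
              le_ciSup (hb fun i => ∑ t, boolSign (!s t) * (2 * F i (z t))) i
            have : ∑ t, boolSign (s t) * (F i (z' t) - F i (z t))
                = (∑ t, boolSign (s t) * (2 * F i (z' t))) / 2
                  + (∑ t, boolSign (!s t) * (2 * F i (z t))) / 2 := by
              rw [Finset.sum_div, Finset.sum_div, ← Finset.sum_add_distrib]
              refine Finset.sum_congr rfl fun t _ => ?_
              by_cases h : s t <;> simp [h, boolSign] <;> ring
            linarith
          refine (Real.exp_le_exp.2 hAB).trans ?_
          have hA : Real.exp A = Real.exp (A / 2) ^ 2 := by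
            rw [← Real.exp_nat_mul]; congr 1; push_cast; ring
          have hB : Real.exp B = Real.exp (B / 2) ^ 2 := by
            rw [← Real.exp_nat_mul]; congr 1; push_cast; ring
          rw [Real.exp_add, hA, hB]
          nlinarith [sq_nonneg (Real.exp (A / 2) - Real.exp (B / 2))]
      _ = _ := by
          simp only [add_div, mul_add, Finset.sum_add_distrib]
          congr 1
          · rw [Finset.sum_comm]
            refine Finset.sum_congr rfl fun z' _ => ?_
            rw [← Finset.sum_mul, ← Finset.sum_mul, sum_prod_eq_one h1, one_mul]
          · refine Finset.sum_congr rfl fun z _ => ?_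
            rw [← Finset.sum_mul, ← Finset.mul_sum, sum_prod_eq_one h1, mul_one]
  -- Averaged over all `s`, the terms with `s` and with the opposite signs coincide.
  have step3 := Finset.sum_le_sum fun s (_ : s ∈ (Finset.univ : Finset (Fin N → Bool))) => step2 s
  simp only [Finset.sum_const, Finset.card_univ, Fintype.card_pi, Fintype.card_bool,
    Finset.prod_const, Fintype.card_fin, nsmul_eq_mul] at step3
  rw [Finset.sum_comm] at step3
  simp only [← Finset.mul_sum] at step3
  have e : ∀ z : Fin N → X,
      ∑ s : Fin N → Bool, (Real.exp (⨆ i, ∑ t, boolSign (s t) * (2 * F i (z t)))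
          + Real.exp (⨆ i, ∑ t, boolSign (!s t) * (2 * F i (z t)))) / 2
        = ∑ s : Fin N → Bool, Real.exp (⨆ i, ∑ t, boolSign (s t) * (2 * F i (z t))) := fun z => by
    rw [← Finset.sum_div, Finset.sum_add_distrib,
      sum_bool_not fun s => Real.exp (⨆ i, ∑ t, boolSign (s t) * (2 * F i (z t)))]
    ring
  simp only [e] at step3
  push_cast at step3
  rw [inv_mul_eq_div, le_div_iff₀ (by positivity)]
  linarith

end FiniteProduct

/-! ### Uniform deviation over an `ℓ_{2,1}` ball, localized to an event -/

section UniformDeviation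

variable {X : Type*} [Fintype X] {N : ℕ} {μ : X → ℝ}
variable {E : Type*} [NormedAddCommGroup E] [InnerProductSpace ℝ E]
variable {R : Type*} [Fintype R]

theorem cosh_sub_one_le_sq {a : ℝ} (ha : |a| ≤ 1) : Real.cosh a - 1 ≤ a ^ 2 := by
  have h2 : a ^ 2 ≤ 1 := by rwa [sq_le_one_iff_abs_le_one]
  have h := Real.cosh_le_exp_half_sq a
  have h3 := Real.abs_exp_sub_one_sub_id_le (x := a ^ 2 / 2) (by
    rw [abs_of_nonneg (by positivity)]; linarith)
  have := le_abs_self (Real.exp (a ^ 2 / 2) - 1 - a ^ 2 / 2)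
  nlinarith [sq_nonneg a]

variable {ι : Type*} [Finite ι] [Nonempty ι]

/-- By duality of `ℓ_{2,1}` and `ℓ_{2,∞}` the supremum is at most the largest row norm of the signed
sum. Bounding `exp` by `2 cosh` and the maximum over rows by the sum yields a factor `2 * card R`
after summation. -/
theorem sum_exp_iSup_rademacher_le [Nonempty R] (y : Fin N → R → E) (w : ι → R → E)
    (hw : ∀ i, ∑ l, ‖w i l‖ ≤ 1) :
    ∑ s : Fin N → Bool, Real.exp (⨆ i, ∑ t, boolSign (s t) * ∑ l, inner ℝ (w i l) (y t l))
      ≤ 2 * 2 ^ N * ∑ l, ∏ t, Real.cosh ‖y t l‖ := by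
  have key : ∀ s : Fin N → Bool,
      Real.exp (⨆ i, ∑ t, boolSign (s t) * ∑ l, inner ℝ (w i l) (y t l))
        ≤ ∑ l, 2 * Real.cosh ‖∑ t, boolSign (s t) • y t l‖ := fun s => by
    obtain ⟨m, hm⟩ := Finite.exists_max fun l => ‖∑ t, boolSign (s t) • y t l‖
    have h1 : (⨆ i, ∑ t, boolSign (s t) * ∑ l, inner ℝ (w i l) (y t l))
        ≤ ‖∑ t, boolSign (s t) • y t m‖ := by
      refine ciSup_le fun i => ?_
      calc _ = ∑ l, inner ℝ (w i l) (∑ t, boolSign (s t) • y t l) := by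
            simp only [inner_sum, inner_smul_right, Finset.mul_sum]
            exact Finset.sum_comm
        _ ≤ ∑ l, ‖w i l‖ * ‖∑ t, boolSign (s t) • y t m‖ := Finset.sum_le_sum fun l _ =>
            (real_inner_le_norm _ _).trans
              (mul_le_mul_of_nonneg_left (hm l) (norm_nonneg _))
        _ ≤ _ := by
            rw [← Finset.sum_mul]
            exact mul_le_of_le_one_left (norm_nonneg _) (hw i)
    refine (Real.exp_le_exp.2 h1).trans ?_
    have h2 : Real.exp ‖∑ t, boolSign (s t) • y t m‖
        ≤ 2 * Real.cosh ‖∑ t, boolSign (s t) • y t m‖ := by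
      rw [Real.cosh_eq]
      have := Real.exp_pos (-‖∑ t, boolSign (s t) • y t m‖)
      linarith
    refine h2.trans (Finset.single_le_sum
      (f := fun l => 2 * Real.cosh ‖∑ t, boolSign (s t) • y t l‖) (fun l _ => ?_)
      (Finset.mem_univ m))
    have := Real.cosh_pos ‖∑ t, boolSign (s t) • y t l‖
    positivity
  refine (Finset.sum_le_sum fun s _ => key s).trans ?_
  rw [Finset.sum_comm, Finset.mul_sum]
  refine Finset.sum_le_sum fun l _ => ?_
  rw [← Finset.mul_sum, mul_assoc]
  exact mul_le_mul_of_nonneg_left (sum_cosh_norm_rademacher_le _) (by norm_num)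

/-- The exponential moment of the uniform deviation of a Lipschitz linear class over finitely many
parameters. -/
theorem exp_moment_uniform_deviation [DecidableEq X] [Nonempty R] (h0 : ∀ x, 0 ≤ μ x)
    (h1 : ∑ x, μ x = 1) (G : X → Prop) [DecidablePred G] (g : X → R → E) (hg : ∀ x l, ‖g x l‖ ≤ 1)
    (ψ : X → ℝ → ℝ) (hψ0 : ∀ x, ψ x 0 = 0) (hψ : ∀ x u v, |ψ x u - ψ x v| ≤ |u - v|)
    {r a : ℝ} (hr : 0 < r) (ha : 0 < a) (ha1 : a ≤ 1) (w : ι → R → E)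
    (hw : ∀ i, ∑ l, ‖w i l‖ ≤ r) :
    ∑ z : Fin N → X, (∏ t, μ (z t)) * Real.exp (⨆ i, ∑ t,
        ((∑ x, μ x * (a / (2 * r) * if G x then ψ x (∑ l, inner ℝ (w i l) (g x l)) else 0))
          - a / (2 * r) * if G (z t) then ψ (z t) (∑ l, inner ℝ (w i l) (g (z t) l)) else 0))
      ≤ 2 * Fintype.card R * Real.exp (N * (∑ x, if G x then μ x else 0) * a ^ 2) := by
  classical
  have hp : ∀ z : Fin N → X, 0 ≤ ∏ t, μ (z t) := fun z => Finset.prod_nonneg fun t _ => h0 _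
  refine (exp_moment_symmetrization h0 h1 (fun i x =>
    a / (2 * r) * if G x then ψ x (∑ l, inner ℝ (w i l) (g x l)) else 0)).trans ?_
  have key : ∀ z : Fin N → X, ∑ s : Fin N → Bool, Real.exp (⨆ i, ∑ t, boolSign (s t) *
      (2 * (a / (2 * r) * if G (z t) then ψ (z t) (∑ l, inner ℝ (w i l) (g (z t) l)) else 0)))
      ≤ 2 * 2 ^ N * (Fintype.card R * ∏ t, if G (z t) then Real.cosh a else 1) := fun z => by
    have hc : 2 * (a / (2 * r)) = a / r := by field_simp
    have hpos : 0 < a / r := by positivity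
    -- The factor `2 * (a / (2 r)) = a / r` is shared out: `r⁻¹` normalizes the coefficients and `a`
    -- scales the features. Samples outside `G` contribute zero.
    have c1 := sum_exp_iSup_contraction (fun _ : ι => (0 : ℝ))
      (fun t i => 2 * (a / (2 * r) *
        if G (z t) then ψ (z t) (∑ l, inner ℝ (w i l) (g (z t) l)) else 0))
      (fun t i => ∑ l, inner ℝ (r⁻¹ • w i l) (if G (z t) then a • g (z t) l else 0))
      (fun t i => by
        by_cases h : G (z t)
        · have := hψ (z t) (∑ l, inner ℝ (w i l) (g (z t) l)) 0
          simp only [h, if_true, inner_smul_left, inner_smul_right, ← Finset.mul_sum,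
            conj_trivial]
          rw [hψ0, sub_zero, sub_zero] at this
          rw [← mul_assoc, hc, ← mul_assoc, ← div_eq_mul_inv, abs_mul, abs_mul]
          gcongr
        · simp [h])
      (fun t i j => by
        by_cases h : G (z t)
        · have := hψ (z t) (∑ l, inner ℝ (w i l) (g (z t) l)) (∑ l, inner ℝ (w j l) (g (z t) l))
          simp only [h, if_true, inner_smul_left, inner_smul_right, ← Finset.mul_sum,
            conj_trivial]
          rw [← mul_assoc, hc, ← mul_assoc, ← mul_assoc, hc, ← mul_assoc, ← div_eq_mul_inv, ← mul_sub, ← mul_sub, abs_mul, abs_mul]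
          gcongr
        · simp [h])
    simp only [zero_add] at c1
    refine c1.trans ((sum_exp_iSup_rademacher_le _ _ fun i => ?_).trans ?_)
    · simp only [norm_smul, ← Finset.mul_sum, norm_inv, Real.norm_eq_abs, abs_of_pos hr]
      rw [inv_mul_le_one₀ hr]
      exact hw i
    · refine mul_le_mul_of_nonneg_left ?_ (by positivity)
      rw [← nsmul_eq_mul, ← Finset.card_univ, ← Finset.sum_const]
      refine Finset.sum_le_sum fun l _ => Finset.prod_le_prod
        (fun t _ => (Real.cosh_pos _).le) fun t _ => ?_
      by_cases h : G (z t)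
      · simp only [h, if_true]
        rw [Real.cosh_le_cosh, abs_norm, norm_smul, abs_of_pos ha, Real.norm_eq_abs,
          abs_of_pos ha]
        exact mul_le_of_le_one_right ha.le (hg _ _)
      · simp [h]
  calc _ ≤ (2 ^ N)⁻¹ * ∑ z : Fin N → X, (∏ t, μ (z t)) *
        (2 * 2 ^ N * (Fintype.card R * ∏ t, if G (z t) then Real.cosh a else 1)) := by
        refine mul_le_mul_of_nonneg_left ?_ (by positivity)
        exact Finset.sum_le_sum fun z _ => mul_le_mul_of_nonneg_left (key z) (hp z)
    _ = 2 * Fintype.card R * (∑ x, μ x * if G x then Real.cosh a else 1) ^ N := by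
        rw [← sum_prod_mul_prod, Finset.mul_sum, Finset.mul_sum]
        refine Finset.sum_congr rfl fun z _ => ?_
        field_simp
    _ ≤ _ := by
        refine mul_le_mul_of_nonneg_left ?_ (by positivity)
        have hq : 0 ≤ ∑ x, if G x then μ x else 0 :=
          Finset.sum_nonneg fun x _ => by split_ifs <;> simp [h0]
        -- One sample contributes `1 + q (cosh a - 1) ≤ exp (q a²)`, with `q` the probability of
        -- `G`; this is the source of the localization.
        have e : (∑ x, μ x * if G x then Real.cosh a else 1)
            = (Real.cosh a - 1) * (∑ x, if G x then μ x else 0) + 1 := by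
          rw [Finset.mul_sum]
          nth_rewrite 3 [← h1]
          rw [← Finset.sum_add_distrib]
          refine Finset.sum_congr rfl fun x _ => ?_
          split_ifs <;> ring
        have hca := cosh_sub_one_le_sq (a := a) (by rwa [abs_of_pos ha])
        have hca0 := Real.one_le_cosh a
        rw [e, mul_assoc, Real.exp_nat_mul]
        apply pow_le_pow_left₀ (by nlinarith)
        refine (Real.add_one_le_exp _).trans (Real.exp_le_exp.2 ?_)
        nlinarith

/-- Uniform deviation of the empirical means from the mean, for a class of `1`-Lipschitz functions
of linear functionals with `ℓ_{2,1}`-bounded coefficients, supported on an event `G`. -/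
theorem uniform_deviation [DecidableEq X] [Nonempty R] (h0 : ∀ x, 0 ≤ μ x)
    (h1 : ∑ x, μ x = 1) (G : X → Prop) [DecidablePred G] (g : X → R → E) (hg : ∀ x l, ‖g x l‖ ≤ 1)
    (ψ : X → ℝ → ℝ) (hψ0 : ∀ x, ψ x 0 = 0) (hψ : ∀ x u v, |ψ x u - ψ x v| ≤ |u - v|)
    {r T q : ℝ} (hr : 0 < r) (hq : q = ∑ x, if G x then μ x else 0) (hT : 0 < T)
    (hTq : T ≤ N * q) (B : Finset (Fin N → X))
    (hB : ∀ z ∈ B, ∃ w : R → E, ∑ l, ‖w l‖ ≤ r ∧ 4 * r * Real.sqrt (T * (N * q)) < ∑ t,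
        ((∑ x, μ x * if G x then ψ x (∑ l, inner ℝ (w l) (g x l)) else 0)
          - if G (z t) then ψ (z t) (∑ l, inner ℝ (w l) (g (z t) l)) else 0)) :
    ∑ z ∈ B, ∏ t, μ (z t) ≤ 2 * Fintype.card R * Real.exp (-T) := by
  classical
  have hp : ∀ z : Fin N → X, 0 ≤ ∏ t, μ (z t) := fun z => Finset.prod_nonneg fun t _ => h0 _
  rcases B.eq_empty_or_nonempty with rfl | hne
  · simp; positivity
  have : Nonempty B := hne.coe_sort
  -- One witness per bad sample makes the index set of the supremum finite.
  choose! w hw using hB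
  have hNq : 0 < N * q := hT.trans_le hTq
  -- With this `a` the exponential moment is at most `2 * card R * e^T`, while the exponent is at
  -- least `2 T` on `B`; Markov's inequality leaves `e^{-T}`. The hypothesis `hTq` is exactly `a ≤
  -- 1`.
  set a := Real.sqrt (T / (N * q)) with ha_def
  have ha : 0 < a := Real.sqrt_pos.2 (by positivity)
  have ha1 : a ≤ 1 := Real.sqrt_le_one.2 ((div_le_one hNq).2 hTq)
  have ha2 : a ^ 2 = T / (N * q) := Real.sq_sqrt (by positivity)
  have hcancel : N * q * (T / (N * q)) = T := by
    rw [mul_comm]; exact div_mul_cancel₀ T hNq.ne'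
  have haT : Real.sqrt (T * (N * q)) = T / a := by
    rw [eq_div_iff ha.ne', ha_def, ← Real.sqrt_mul (by positivity)]
    rw [mul_assoc, hcancel]
    exact Real.sqrt_mul_self hT.le
  have main := exp_moment_uniform_deviation (N := N) h0 h1 G g hg ψ hψ0 hψ hr ha ha1
    (fun z : B => w z.1) (fun z => (hw z.1 z.2).1)
  rw [← hq, ha2, hcancel] at main
  have lower : ∀ z ∈ B, Real.exp (2 * T) ≤ Real.exp (⨆ i : B, ∑ t,
        ((∑ x, μ x * (a / (2 * r) * if G x then ψ x (∑ l, inner ℝ (w i l) (g x l)) else 0))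
          - a / (2 * r) * if G (z t) then ψ (z t) (∑ l, inner ℝ (w i l) (g (z t) l)) else 0)) := by
    intro z hz
    apply Real.exp_le_exp.2
    refine le_trans ?_ (le_ciSup (Set.finite_range _).bddAbove (⟨z, hz⟩ : B))
    have := (hw z hz).2
    rw [haT] at this
    have h3 := mul_le_mul_of_nonneg_left this.le (show 0 ≤ a / (2 * r) by positivity)
    rw [show a / (2 * r) * (4 * r * (T / a)) = 2 * T by field_simp; ring] at h3
    refine h3.trans (le_of_eq ?_)
    rw [Finset.mul_sum]
    refine Finset.sum_congr rfl fun t _ => ?_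
    rw [mul_sub, Finset.mul_sum]
    congr 1
    exact Finset.sum_congr rfl fun x _ => by ring
  have h3 : Real.exp (2 * T) * ∑ z ∈ B, ∏ t, μ (z t) ≤ 2 * Fintype.card R * Real.exp T := by
    refine le_trans ?_ main
    rw [Finset.mul_sum]
    refine le_trans (Finset.sum_le_sum fun z hz => ?_)
      (Finset.sum_le_sum_of_subset_of_nonneg (Finset.subset_univ B)
        fun z _ _ => mul_nonneg (hp z) (Real.exp_pos _).le)
    rw [mul_comm]
    exact mul_le_mul_of_nonneg_left (lower z hz) (hp z)
  rw [← le_div_iff₀' (Real.exp_pos _)] at h3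
  refine h3.trans (le_of_eq ?_)
  rw [mul_div_assoc, ← Real.exp_sub]
  ring_nf

end UniformDeviation

/-! ### The logistic loss and its Bregman divergence -/

section Softplus

/-- The function `ln (1 + e^x)`. -/
noncomputable def softplus (x : ℝ) : ℝ := Real.log (1 + Real.exp x)

theorem softplus_nonneg (x : ℝ) : 0 ≤ softplus x :=
  Real.log_nonneg (by linarith [Real.exp_pos x])

theorem softplus_zero : softplus 0 = Real.log 2 := by
  norm_num [softplus]

theorem softplus_le_exp (x : ℝ) : softplus x ≤ Real.exp x := by
  have := Real.log_le_sub_one_of_pos (show 0 < 1 + Real.exp x by positivity)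
  simpa [softplus] using this

theorem softplus_eq_add_softplus_neg (x : ℝ) : softplus x = x + softplus (-x) := by
  have h : 1 + Real.exp x = Real.exp x * (1 + Real.exp (-x)) := by
    rw [mul_add, ← Real.exp_add]; simp [add_comm]
  rw [softplus, h, Real.log_mul (Real.exp_ne_zero _) (by positivity), Real.log_exp, softplus]

theorem softplus_mono {x y : ℝ} (h : x ≤ y) : softplus x ≤ softplus y :=
  Real.log_le_log (by positivity) (by linarith [Real.exp_le_exp.2 h])

theorem softplus_sub_le {x y : ℝ} (h : x ≤ y) : softplus y - softplus x ≤ y - x := by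
  have h1 := softplus_eq_add_softplus_neg x
  have h2 := softplus_eq_add_softplus_neg y
  have h3 := softplus_mono (neg_le_neg h)
  linarith

theorem abs_softplus_sub_le (x y : ℝ) : |softplus x - softplus y| ≤ |x - y| := by
  rcases le_total x y with h | h
  · rw [abs_sub_comm, abs_sub_comm x, abs_of_nonneg (sub_nonneg.2 (softplus_mono h)),
      abs_of_nonneg (sub_nonneg.2 h)]
    exact softplus_sub_le h
  · rw [abs_of_nonneg (sub_nonneg.2 (softplus_mono h)), abs_of_nonneg (sub_nonneg.2 h)]
    exact softplus_sub_le h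

theorem sigmoid_eq_exp_div (x : ℝ) : Real.sigmoid x = Real.exp x / (1 + Real.exp x) := by
  rw [Real.sigmoid_def, Real.exp_neg]
  field_simp
  ring

/-- Convexity, derived without derivatives: with `σ = sigmoid a`, convexity of `exp` gives
`e^{σ(u-a)} ≤ σ e^{u-a} + 1 - σ = (1 + e^u)/(1 + e^a)`. Take logarithms. -/
theorem softplus_tangent_le (a u : ℝ) :
    softplus a + Real.sigmoid a * (u - a) ≤ softplus u := by
  have hs : 0 ≤ Real.sigmoid a := Real.sigmoid_nonneg a
  have hs1 : Real.sigmoid a ≤ 1 := Real.sigmoid_le_one a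
  have h := convexOn_exp.2 (Set.mem_univ (u - a)) (Set.mem_univ 0) hs (sub_nonneg.2 hs1)
    (by ring)
  simp only [smul_eq_mul, mul_zero, add_zero, Real.exp_zero, mul_one] at h
  have h2 : Real.sigmoid a * Real.exp (u - a) + (1 - Real.sigmoid a)
      = (1 + Real.exp u) / (1 + Real.exp a) := by
    rw [sigmoid_eq_exp_div, Real.exp_sub]
    field_simp
    ring
  rw [h2] at h
  have h3 := Real.log_le_log (Real.exp_pos _) h
  rw [Real.log_exp, Real.log_div (by positivity) (by positivity)] at h3
  simp only [softplus]
  linarith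

/-- The Bregman divergence of `softplus`. -/
noncomputable def softplusBregman (a u : ℝ) : ℝ :=
  softplus u - softplus a - Real.sigmoid a * (u - a)

theorem softplusBregman_nonneg (a u : ℝ) : 0 ≤ softplusBregman a u := by
  have := softplus_tangent_le a u
  unfold softplusBregman
  linarith

theorem exp_neg_abs_le_sigmoid_mul (a : ℝ) :
    Real.exp (-|a|) / 4 ≤ Real.sigmoid a * (1 - Real.sigmoid a) := by
  wlog h : 0 ≤ a generalizing a
  · have := this (-a) (by linarith)
    rw [abs_neg, Real.sigmoid_neg] at this
    linarith
  rw [abs_of_nonneg h, sigmoid_eq_exp_div, Real.exp_neg]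
  have h1 : 1 ≤ Real.exp a := Real.one_le_exp h
  rw [show Real.exp a / (1 + Real.exp a) * (1 - Real.exp a / (1 + Real.exp a))
    = Real.exp a / (1 + Real.exp a) ^ 2 by field_simp; ring, ← one_div, div_div,
    div_le_div_iff₀ (by positivity) (by positivity)]
  nlinarith

/-- The increment is at least `σ(1 - σ)(1 - e^{-s})` with `σ = sigmoid a`, where `σ(1 - σ) ≥
e^{-|a|}/4` and `1 - e^{-s} ≥ min s 1 / 2`. -/
theorem sigmoid_sub_ge {a s : ℝ} (hs : 0 ≤ s) :
    Real.exp (-|a|) / 8 * min s 1 ≤ Real.sigmoid (a + s) - Real.sigmoid a := by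
  have h1 : min s 1 / 2 ≤ 1 - Real.exp (-s) := by
    have h2 : Real.exp (-s) * (1 + s) ≤ 1 := by
      rw [Real.exp_neg, inv_mul_le_one₀ (Real.exp_pos s)]
      linarith [Real.add_one_le_exp s]
    have h3 : Real.exp (-s) ≤ 1 / (1 + s) := by
      rwa [le_div_iff₀ (by linarith)]
    have h4 : min s 1 / 2 ≤ 1 - 1 / (1 + s) := by
      rw [show 1 - 1 / (1 + s) = s / (1 + s) by field_simp; ring, div_le_div_iff₀ (by norm_num)
        (by linarith)]
      rcases le_total s 1 with h | h
      · rw [min_eq_left h]; nlinarith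
      · rw [min_eq_right h]; nlinarith
    linarith
  have h2 : Real.sigmoid a * (1 - Real.sigmoid a) * (1 - Real.exp (-s))
      ≤ Real.sigmoid (a + s) - Real.sigmoid a := by
    rw [sigmoid_eq_exp_div, sigmoid_eq_exp_div, Real.exp_add, Real.exp_neg]
    have hx := Real.exp_pos a
    have hy : 1 ≤ Real.exp s := Real.one_le_exp hs
    set x := Real.exp a
    set y := Real.exp s
    rw [show x * y / (1 + x * y) - x / (1 + x) = x * (y - 1) / ((1 + x * y) * (1 + x)) by
      field_simp; ring,
      show x / (1 + x) * (1 - x / (1 + x)) * (1 - y⁻¹) = x * (y - 1) / ((1 + x) * y * (1 + x)) by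
      field_simp; ring]
    apply div_le_div_of_nonneg_left (mul_nonneg hx.le (by linarith)) (by positivity)
    apply mul_le_mul_of_nonneg_right _ (by linarith)
    nlinarith
  refine le_trans ?_ h2
  have h3 := exp_neg_abs_le_sigmoid_mul a
  have h4 : 0 ≤ min s 1 := le_min hs zero_le_one
  calc Real.exp (-|a|) / 8 * min s 1 = Real.exp (-|a|) / 4 * (min s 1 / 2) := by ring
    _ ≤ _ := by
      apply mul_le_mul h3 h1 (by positivity)
      exact (by positivity : 0 ≤ Real.exp (-|a|) / 4).trans h3

/-- Tangents at `a` and at the midpoint of `a` and `u` bound the divergence below by the slope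
increment times half the distance. As the loss is asymptotically linear, no quadratic bound can hold
for large `|u - a|`. -/
theorem softplusBregman_ge (a u : ℝ) :
    Real.exp (-|a|) / 32 * min |u - a| ((u - a) ^ 2) ≤ softplusBregman a u := by
  have key : Real.exp (-|a|) / 8 * min (|u - a| / 2) 1 * (|u - a| / 2)
      ≤ softplusBregman a u := by
    have t1 := softplus_tangent_le ((a + u) / 2) u
    have t2 := softplus_tangent_le a ((a + u) / 2)
    unfold softplusBregman
    rcases le_total a u with h | h
    · have h0 : 0 ≤ (u - a) / 2 := by linarith
      have t3 := sigmoid_sub_ge (a := a) h0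
      rw [show a + (u - a) / 2 = (a + u) / 2 by ring] at t3
      rw [abs_of_nonneg (by linarith : 0 ≤ u - a)]
      have := mul_le_mul_of_nonneg_right t3 h0
      linarith
    -- The case `u ≤ a` is reflected through `sigmoid (-a) = 1 - sigmoid a`.
    · have h0 : 0 ≤ (a - u) / 2 := by linarith
      have t3 := sigmoid_sub_ge (a := -a) h0
      rw [show -a + (a - u) / 2 = -((a + u) / 2) by ring, Real.sigmoid_neg, Real.sigmoid_neg,
        abs_neg] at t3
      rw [abs_of_nonpos (by linarith : u - a ≤ 0), neg_sub]
      have := mul_le_mul_of_nonneg_right t3 h0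
      linarith
  refine le_trans ?_ key
  have h0 := abs_nonneg (u - a)
  rw [← sq_abs (u - a)]
  set t := |u - a|
  have hmin : min t (t ^ 2) / 4 ≤ min (t / 2) 1 * (t / 2) := by
    rcases le_total (t / 2) 1 with h | h
    · rw [min_eq_left h]; linarith [min_le_right t (t ^ 2)]
    · rw [min_eq_right h]; linarith [min_le_left t (t ^ 2)]
  calc _ = Real.exp (-|a|) / 8 * (min t (t ^ 2) / 4) := by ring
    _ ≤ Real.exp (-|a|) / 8 * (min (t / 2) 1 * (t / 2)) :=
        mul_le_mul_of_nonneg_left hmin (by positivity)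
    _ = _ := by ring

theorem softplus_le_sigmoid_mul (a : ℝ) : softplus a ≤ Real.sigmoid a * (2 * |a| + 2) := by
  rcases le_total a 0 with h | h
  · have h1 := softplus_le_exp a
    have h2 : Real.exp a ≤ 1 := Real.exp_le_one_iff.2 h
    have h3 : Real.exp a = Real.sigmoid a * (1 + Real.exp a) := by
      rw [sigmoid_eq_exp_div]; field_simp
    have h4 := Real.sigmoid_nonneg a
    have h5 := abs_nonneg a
    nlinarith
  · have h1 := softplus_eq_add_softplus_neg a
    have h2 := softplus_le_exp (-a)
    have h3 : Real.exp (-a) ≤ 1 := Real.exp_le_one_iff.2 (by linarith)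
    have h4 : 1 / 2 ≤ Real.sigmoid a := by
      rw [sigmoid_eq_exp_div, div_le_div_iff₀ (by norm_num) (by positivity)]
      linarith [Real.one_le_exp h]
    rw [abs_of_nonneg h]
    nlinarith

/-- For very negative deviations the Bregman divergence, divided by the sigmoid, is almost the
absolute value of the deviation. -/
theorem softplusBregman_mul_ge (a u : ℝ) :
    -(u - a) - (2 * |a| + 2) ≤ (1 + Real.exp (-a)) * softplusBregman a u := by
  have h1 : (1 + Real.exp (-a)) * Real.sigmoid a = 1 := by
    rw [sigmoid_eq_exp_div, Real.exp_neg]; field_simp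
    ring
  have h2 : Real.sigmoid a * (-(u - a) - (2 * |a| + 2)) ≤ softplusBregman a u := by
    unfold softplusBregman
    linarith [softplus_nonneg u, softplus_le_sigmoid_mul a]
  have h3 := mul_le_mul_of_nonneg_left h2 (show 0 ≤ 1 + Real.exp (-a) by positivity)
  rwa [← mul_assoc, h1, one_mul] at h3

theorem softplus_sub_ge_half {u τ : ℝ} (hτ : 0 ≤ τ) (h : 0 ≤ u - τ) :
    τ / 2 ≤ softplus u - softplus (u - τ) := by
  have t := softplus_tangent_le (u - τ) u
  have h4 : 1 / 2 ≤ Real.sigmoid (u - τ) := by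
    rw [sigmoid_eq_exp_div, div_le_div_iff₀ (by norm_num) (by positivity)]
    linarith [Real.one_le_exp h]
  nlinarith

end Softplus

/-! ### Conditional logits of the model and the width -/

namespace PairwiseModel

variable {n k : ℕ} (M : PairwiseModel n k)

/-- The conditional logit of the symbol `b` at the variable `j`, given the other variables. -/
noncomputable def localField (j : Fin n) (z : Fin n → Fin k) (b : Fin k) : ℝ :=
  ∑ l ∈ Finset.univ.filter (fun l => l ≠ j), M.W j l b (z l) + M.θ j b

/-- The probability mass function of the model. -/
noncomputable def mass (z : Fin n → Fin k) : ℝ := Real.exp (M.exponent z) / M.partition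

theorem localField_update (j : Fin n) (z : Fin n → Fin k) (a b : Fin k) :
    M.localField j (Function.update z j a) b = M.localField j z b := by
  unfold localField
  congr 1
  refine Finset.sum_congr rfl fun l hl => ?_
  rw [Function.update_of_ne (Finset.mem_filter.1 hl).2]

/-- Isolates everything that depends on `z j`. Pairs `i < j` are brought to row `j` by the symmetry
of the weights. -/
theorem exponent_eq_localField_add (j : Fin n) (z : Fin n → Fin k) :
    M.exponent z = M.localField j z (z j)
      + (∑ i ∈ Finset.univ.erase j, ∑ l ∈ Finset.univ.erase j,
          (if i < l then M.W i l (z i) (z l) else 0)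
        + ∑ i ∈ Finset.univ.erase j, M.θ i (z i)) := by
  unfold exponent localField
  simp only [Finset.sum_filter]
  rw [← Finset.add_sum_erase _ _ (Finset.mem_univ j),
    ← Finset.add_sum_erase _ (fun i => M.θ i (z i)) (Finset.mem_univ j),
    ← Finset.add_sum_erase _ (fun l => if j < l then M.W j l (z j) (z l) else 0)
      (Finset.mem_univ j),
    ← Finset.add_sum_erase _ (fun l => if l ≠ j then M.W j l (z j) (z l) else 0)
      (Finset.mem_univ j)]
  have e : ∑ i ∈ Finset.univ.erase j, ∑ l, (if i < l then M.W i l (z i) (z l) else 0)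
      = ∑ i ∈ Finset.univ.erase j, ((if i < j then M.W j i (z j) (z i) else 0)
        + ∑ l ∈ Finset.univ.erase j, if i < l then M.W i l (z i) (z l) else 0) := by
    refine Finset.sum_congr rfl fun i hi => ?_
    rw [← Finset.add_sum_erase _ _ (Finset.mem_univ j)]
    rw [M.symm i j (Finset.ne_of_mem_erase hi)]
    rfl
  have e2 : ∑ l ∈ Finset.univ.erase j, (if l ≠ j then M.W j l (z j) (z l) else 0)
      = ∑ l ∈ Finset.univ.erase j, (if j < l then M.W j l (z j) (z l) else 0)
        + ∑ l ∈ Finset.univ.erase j, (if l < j then M.W j l (z j) (z l) else 0) := by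
    rw [← Finset.sum_add_distrib]
    refine Finset.sum_congr rfl fun l hl => ?_
    rcases lt_or_gt_of_ne (Finset.ne_of_mem_erase hl) with h | h
    · simp [h, h.ne, h.not_gt]
    · simp [h, h.ne', h.not_gt]
  rw [e, e2, Finset.sum_add_distrib]
  simp only [lt_self_iff_false, if_false, ne_eq, not_true_eq_false]
  ring

theorem exponent_update_sub (j : Fin n) (z : Fin n → Fin k) (a b : Fin k) :
    M.exponent (Function.update z j a) - M.exponent (Function.update z j b)
      = M.localField j z a - M.localField j z b := by
  rw [M.exponent_eq_localField_add j, M.exponent_eq_localField_add j,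
    localField_update, localField_update, Function.update_self, Function.update_self]
  have h1 : ∀ c, ∑ i ∈ Finset.univ.erase j, ∑ l ∈ Finset.univ.erase j,
          (if i < l then M.W i l (Function.update z j c i) (Function.update z j c l) else 0)
      = ∑ i ∈ Finset.univ.erase j, ∑ l ∈ Finset.univ.erase j,
          (if i < l then M.W i l (z i) (z l) else 0) := fun c => by
    refine Finset.sum_congr rfl fun i hi => Finset.sum_congr rfl fun l hl => ?_
    rw [Function.update_of_ne (Finset.ne_of_mem_erase hi),
      Function.update_of_ne (Finset.ne_of_mem_erase hl)]
  have h2 : ∀ c, ∑ i ∈ Finset.univ.erase j, M.θ i (Function.update z j c i)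
      = ∑ i ∈ Finset.univ.erase j, M.θ i (z i) := fun c => by
    refine Finset.sum_congr rfl fun i hi => ?_
    rw [Function.update_of_ne (Finset.ne_of_mem_erase hi)]
  rw [h1, h1, h2, h2]
  ring

theorem partition_pos [NeZero k] : 0 < M.partition :=
  Finset.sum_pos (fun _ _ => Real.exp_pos _) Finset.univ_nonempty

theorem mass_pos [NeZero k] (z : Fin n → Fin k) : 0 < M.mass z :=
  div_pos (Real.exp_pos _) M.partition_pos

theorem sum_mass [NeZero k] : ∑ z, M.mass z = 1 := by
  unfold mass
  rw [← Finset.sum_div]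
  exact div_self M.partition_pos.ne'

theorem mass_update (j : Fin n) (z : Fin n → Fin k) (a b : Fin k) :
    M.mass (Function.update z j a)
      = Real.exp (M.localField j z a - M.localField j z b) * M.mass (Function.update z j b) := by
  unfold mass
  rw [← exponent_update_sub, mul_div_assoc', ← Real.exp_add]
  ring_nf

theorem dist_singleton (z : Fin n → Fin k) : M.dist {z} = ENNReal.ofReal (M.mass z) := by
  unfold dist
  rw [Measure.finsetSum_apply, Finset.sum_eq_single z]
  · simp [mass]
  · intro b _ hb
    simp [hb]
  · simp

section Width

theorem le_width (i : Fin n) (a : Fin k) :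
    (∑ j ∈ Finset.univ.filter (fun j => j ≠ i), ⨆ b : Fin k, |M.W i j a b|) + |M.θ i a|
      ≤ M.width := by
  unfold width
  refine le_trans ?_ (le_ciSup (Set.finite_range _).bddAbove i)
  exact le_ciSup (f := fun a => (∑ j ∈ Finset.univ.filter (fun j => j ≠ i),
    ⨆ b : Fin k, |M.W i j a b|) + |M.θ i a|) (Set.finite_range _).bddAbove a

theorem width_nonneg : 0 ≤ M.width := by
  unfold width
  refine Real.iSup_nonneg fun i => Real.iSup_nonneg fun a => ?_
  refine add_nonneg (Finset.sum_nonneg fun j _ => Real.iSup_nonneg fun b => abs_nonneg _)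
    (abs_nonneg _)

theorem abs_W_le_iSup (i j : Fin n) (a b : Fin k) : |M.W i j a b| ≤ ⨆ b, |M.W i j a b| :=
  le_ciSup (f := fun b => |M.W i j a b|) (Set.finite_range _).bddAbove b

theorem abs_localField_le (j : Fin n) (z : Fin n → Fin k) (b : Fin k) :
    |M.localField j z b| ≤ M.width := by
  refine le_trans ?_ (M.le_width j b)
  unfold localField
  refine (abs_add_le _ _).trans (add_le_add_left ?_ _)
  refine (Finset.abs_sum_le_sum_abs _ _).trans (Finset.sum_le_sum fun l _ => ?_)
  exact M.abs_W_le_iSup _ _ _ _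

theorem abs_W_le_width {i j : Fin n} (h : j ≠ i) (a b : Fin k) : |M.W i j a b| ≤ M.width := by
  refine le_trans ?_ (M.le_width i a)
  refine (M.abs_W_le_iSup i j a b).trans ?_
  have := Finset.single_le_sum (f := fun j => ⨆ b : Fin k, |M.W i j a b|)
    (s := Finset.univ.filter (fun j => j ≠ i)) (fun j _ => Real.iSup_nonneg fun b => abs_nonneg _)
    (Finset.mem_filter.2 ⟨Finset.mem_univ j, h⟩)
  have h2 := abs_nonneg (M.θ i a)
  linarith

theorem mass_update_le (j : Fin n) (z : Fin n → Fin k) (a b : Fin k) {lam : ℝ}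
    (hl : M.width ≤ lam) :
    M.mass (Function.update z j a)
      ≤ Real.exp (2 * lam) * M.mass (Function.update z j b) := by
  rw [M.mass_update j z a b]
  refine mul_le_mul_of_nonneg_right (Real.exp_le_exp.2 ?_) ?_
  · have h1 := abs_le.1 (M.abs_localField_le j z a)
    have h2 := abs_le.1 (M.abs_localField_le j z b)
    linarith
  · unfold mass partition
    positivity

end Width

end PairwiseModel

/-! ### Changing the value of one variable -/

section Resampling

variable {n k : ℕ}

/-- Change of the value of one variable in a sum over configurations. -/
theorem sum_filter_eq_sum_update (j : Fin n) (a b : Fin k) (F : (Fin n → Fin k) → ℝ) :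
    ∑ z with z j = a, F z = ∑ z with z j = b, F (Function.update z j a) := by
  refine Finset.sum_nbij' (fun z => Function.update z j b) (fun z => Function.update z j a)
    ?_ ?_ ?_ ?_ ?_
  · intro z _; simp
  · intro z _; simp
  · intro z hz
    simp only [Finset.mem_filter, Finset.mem_univ, true_and] at hz
    simp [← hz]
  · intro z hz
    simp only [Finset.mem_filter, Finset.mem_univ, true_and] at hz
    simp [← hz]
  · intro z hz
    simp only [Finset.mem_filter, Finset.mem_univ, true_and] at hz
    simp [← hz]

variable (M : PairwiseModel n k) {lam : ℝ}

theorem sum_filter_mass_update_le [NeZero k] (hl : M.width ≤ lam) (j : Fin n) (a b : Fin k)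
    {H : (Fin n → Fin k) → ℝ} (hH : ∀ z, 0 ≤ H z) :
    ∑ z with z j = b, M.mass z * H (Function.update z j a)
      ≤ Real.exp (2 * lam) * ∑ z with z j = a, M.mass z * H z := by
  rw [sum_filter_eq_sum_update j a b, Finset.mul_sum]
  refine Finset.sum_le_sum fun z hz => ?_
  have hz : z j = b := (Finset.mem_filter.1 hz).2
  have := M.mass_update_le j z b a hl
  rw [← hz, Function.update_eq_self] at this
  rw [← mul_assoc]
  exact mul_le_mul_of_nonneg_right this (hH _)

/-- Each of the `k` fibres of `z j` is moved to the fibre over `a` at cost `e^{2λ}`. This lets `z j`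
be prescribed inside expectations. -/
theorem sum_mass_update_le [NeZero k] (hl : M.width ≤ lam) (j : Fin n) (a : Fin k)
    {H : (Fin n → Fin k) → ℝ} (hH : ∀ z, 0 ≤ H z) :
    ∑ z, M.mass z * H (Function.update z j a)
      ≤ k * Real.exp (2 * lam) * ∑ z with z j = a, M.mass z * H z := by
  rw [← Finset.sum_fiberwise Finset.univ (fun z => z j)]
  refine (Finset.sum_le_sum fun b _ => sum_filter_mass_update_le M hl j a b hH).trans
    (le_of_eq ?_)
  simp [mul_assoc]

end Resampling

/-! ### Linear predictors, true parameters and row norms -/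

namespace PairwiseLearning

variable {n k : ℕ}

theorem matInner_oneHot (w : Matrix (Fin n) (Fin k) ℝ) (z : Fin n → Fin k) :
    matInner w (oneHot z) = ∑ j, w j (z j) := by
  unfold matInner oneHot
  simp

variable [NeZero k]

/-- The linear predictor `⟨w, x⟩` of the variable `i` at the configuration `z`. -/
def predictor (i : Fin n) (w : Matrix (Fin n) (Fin k) ℝ) (z : Fin n → Fin k) : ℝ :=
  matInner w (covariate i z)

theorem predictor_eq (i : Fin n) (w : Matrix (Fin n) (Fin k) ℝ) (z : Fin n → Fin k) :
    predictor i w z = ∑ l, w l (Function.update z i 0 l) := matInner_oneHot _ _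

/-- The part of the linear predictor which does not involve the variable `j`. -/
def predictorRest (i j : Fin n) (w : Matrix (Fin n) (Fin k) ℝ) (z : Fin n → Fin k) : ℝ :=
  ∑ l ∈ Finset.univ.erase j, w l (Function.update z i 0 l)

theorem predictor_eq_rest_add {i j : Fin n} (hij : j ≠ i) (w : Matrix (Fin n) (Fin k) ℝ)
    (z : Fin n → Fin k) : predictor i w z = predictorRest i j w z + w j (z j) := by
  rw [predictor_eq, predictorRest, ← Finset.add_sum_erase _ _ (Finset.mem_univ j),
    Function.update_of_ne hij, add_comm]

theorem predictor_update_self (i : Fin n) (w : Matrix (Fin n) (Fin k) ℝ) (z : Fin n → Fin k)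
    (a : Fin k) : predictor i w (Function.update z i a) = predictor i w z := by
  simp [predictor_eq]

theorem predictorRest_update_self (i j : Fin n) (w : Matrix (Fin n) (Fin k) ℝ)
    (z : Fin n → Fin k) (a : Fin k) :
    predictorRest i j w (Function.update z i a) = predictorRest i j w z := by
  simp [predictorRest]

theorem predictorRest_update (i j : Fin n) (w : Matrix (Fin n) (Fin k) ℝ)
    (z : Fin n → Fin k) (b : Fin k) :
    predictorRest i j w (Function.update z j b) = predictorRest i j w z := by
  unfold predictorRest
  refine Finset.sum_congr rfl fun l hl => ?_
  have hl := Finset.ne_of_mem_erase hl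
  by_cases h : l = i
  · subst h; simp
  · simp [h, hl]

theorem predictor_update {i j : Fin n} (hij : j ≠ i) (w : Matrix (Fin n) (Fin k) ℝ)
    (z : Fin n → Fin k) (b : Fin k) :
    predictor i w (Function.update z j b) = predictorRest i j w z + w j b := by
  rw [predictor_eq_rest_add hij, predictorRest_update, Function.update_self]

theorem predictor_neg (i : Fin n) (w : Matrix (Fin n) (Fin k) ℝ) (z : Fin n → Fin k) :
    predictor i (-w) z = -predictor i w z := by
  simp [predictor_eq]

/-- The parameters of the conditional distribution of the variable `i` on the symbols `α, β`. -/
def trueWeights (M : PairwiseModel n k) (i : Fin n) (α β : Fin k) :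
    Matrix (Fin n) (Fin k) ℝ :=
  Matrix.of fun j b =>
    if j = i then (if b = 0 then M.θ i α - M.θ i β else 0) else M.W i j α b - M.W i j β b

variable (M : PairwiseModel n k) {lam : ℝ}

theorem trueWeights_of_ne {i j : Fin n} (h : j ≠ i) (α β b : Fin k) :
    trueWeights M i α β j b = M.W i j α b - M.W i j β b := by
  simp [trueWeights, h]

theorem trueWeights_swap (i : Fin n) (α β : Fin k) :
    trueWeights M i β α = -trueWeights M i α β := by
  ext j b
  simp only [trueWeights, Matrix.of_apply, Matrix.neg_apply]
  split_ifs <;> ring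

theorem predictor_trueWeights (i : Fin n) (α β : Fin k) (z : Fin n → Fin k) :
    predictor i (trueWeights M i α β) z = M.localField i z α - M.localField i z β := by
  rw [predictor_eq, ← Finset.add_sum_erase _ _ (Finset.mem_univ i)]
  unfold PairwiseModel.localField
  rw [Finset.filter_ne' Finset.univ i]
  have : ∑ l ∈ Finset.univ.erase i, trueWeights M i α β l (Function.update z i 0 l)
      = ∑ l ∈ Finset.univ.erase i, (M.W i l α (z l) - M.W i l β (z l)) := by
    refine Finset.sum_congr rfl fun l hl => ?_
    have hl := Finset.ne_of_mem_erase hl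
    rw [trueWeights_of_ne M hl, Function.update_of_ne hl]
  rw [this, Finset.sum_sub_distrib]
  simp [trueWeights]
  ring

theorem abs_predictor_trueWeights_le (hl : M.width ≤ lam) (i : Fin n) (α β : Fin k)
    (z : Fin n → Fin k) : |predictor i (trueWeights M i α β) z| ≤ 2 * lam := by
  rw [predictor_trueWeights, abs_le]
  have h1 := abs_le.1 (M.abs_localField_le i z α)
  have h2 := abs_le.1 (M.abs_localField_le i z β)
  constructor <;> linarith

theorem sqrt_sum_sq_le_of_abs_le {v : Fin k → ℝ} {c : ℝ} (hc : 0 ≤ c) (h : ∀ b, |v b| ≤ c) :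
    Real.sqrt (∑ b, v b ^ 2) ≤ Real.sqrt k * c := by
  rw [← Real.sqrt_sq hc, ← Real.sqrt_mul (Nat.cast_nonneg k)]
  apply Real.sqrt_le_sqrt
  calc ∑ b, v b ^ 2 ≤ ∑ b : Fin k, c ^ 2 := Finset.sum_le_sum fun b _ => by
        rw [← sq_abs]; exact pow_le_pow_left₀ (abs_nonneg _) (h b) 2
    _ = _ := by simp

/-- Makes the true parameters a competitor in the regression. The `√k` is the cost of passing from
sup to Euclidean norms of rows, the `2` comes from the two symbols. -/
theorem norm21_trueWeights_le (hl : M.width ≤ lam) (i : Fin n) (α β : Fin k) :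
    norm21 (trueWeights M i α β) ≤ 2 * lam * Real.sqrt k := by
  unfold norm21
  have hw : ∀ j a, 0 ≤ ⨆ b, |M.W i j a b| := fun j a => Real.iSup_nonneg fun b => abs_nonneg _
  rw [← Finset.add_sum_erase _ _ (Finset.mem_univ i)]
  have h1 : Real.sqrt (∑ b, trueWeights M i α β i b ^ 2)
      ≤ Real.sqrt k * (|M.θ i α| + |M.θ i β|) := by
    refine sqrt_sum_sq_le_of_abs_le (by positivity) fun b => ?_
    simp only [trueWeights, Matrix.of_apply, if_true]
    split_ifs
    · exact abs_sub _ _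
    · simp; positivity
  have h2 : ∑ j ∈ Finset.univ.erase i, Real.sqrt (∑ b, trueWeights M i α β j b ^ 2)
      ≤ ∑ j ∈ Finset.univ.erase i,
        Real.sqrt k * ((⨆ b, |M.W i j α b|) + ⨆ b, |M.W i j β b|) := by
    refine Finset.sum_le_sum fun j hj => ?_
    refine sqrt_sum_sq_le_of_abs_le (add_nonneg (hw _ _) (hw _ _)) fun b => ?_
    rw [trueWeights_of_ne M (Finset.ne_of_mem_erase hj)]
    exact (abs_sub _ _).trans (add_le_add (M.abs_W_le_iSup _ _ _ _) (M.abs_W_le_iSup _ _ _ _))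
  rw [← Finset.mul_sum, Finset.sum_add_distrib] at h2
  have h3 := M.le_width i α
  have h4 := M.le_width i β
  rw [Finset.filter_ne' Finset.univ i] at h3 h4
  have h5 := mul_le_mul_of_nonneg_left (h3.trans hl) (Real.sqrt_nonneg k)
  have h6 := mul_le_mul_of_nonneg_left (h4.trans hl) (Real.sqrt_nonneg k)
  linarith

theorem center_of_ne {i j : Fin n} (h : j ≠ i) (w : Matrix (Fin n) (Fin k) ℝ) (b : Fin k) :
    center i w j b = w j b - (1 / (k : ℝ)) * ∑ a, w j a := by
  simp [center, h]

theorem abs_row_le_norm21 (w : Matrix (Fin n) (Fin k) ℝ) (j : Fin n) (b : Fin k) :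
    |w j b| ≤ norm21 w := by
  refine le_trans ?_ (Finset.single_le_sum (f := fun j => Real.sqrt (∑ b, w j b ^ 2))
    (fun _ _ => Real.sqrt_nonneg _) (Finset.mem_univ j))
  apply Real.abs_le_sqrt
  exact Finset.single_le_sum (f := fun b => w j b ^ 2) (fun _ _ => sq_nonneg _)
    (Finset.mem_univ b)

/-- Cauchy-Schwarz gains `√k` over the bound for single entries, so row means of feasible matrices
are at most `2λ`. The large error case rests on this. -/
theorem abs_row_mean_le (w : Matrix (Fin n) (Fin k) ℝ) (j : Fin n) :
    |(1 / (k : ℝ)) * ∑ a, w j a| ≤ norm21 w / Real.sqrt k := by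
  have hk : 0 < (k : ℝ) := Nat.cast_pos.2 (NeZero.pos k)
  have h1 : Real.sqrt (∑ b, w j b ^ 2) ≤ norm21 w :=
    Finset.single_le_sum (f := fun j => Real.sqrt (∑ b, w j b ^ 2))
      (fun _ _ => Real.sqrt_nonneg _) (Finset.mem_univ j)
  have h2 : |∑ a, w j a| ≤ Real.sqrt k * Real.sqrt (∑ b, w j b ^ 2) := by
    rw [← Real.sqrt_mul hk.le]
    apply Real.abs_le_sqrt
    have := sq_sum_le_card_mul_sum_sq (s := Finset.univ) (f := fun a => w j a)
    simpa using this
  rw [abs_mul, abs_of_pos (by positivity), le_div_iff₀ (Real.sqrt_pos.2 hk)]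
  have h3 : Real.sqrt k * Real.sqrt k = k := Real.mul_self_sqrt hk.le
  calc 1 / (k : ℝ) * |∑ a, w j a| * Real.sqrt k
      ≤ 1 / (k : ℝ) * (Real.sqrt k * Real.sqrt (∑ b, w j b ^ 2)) * Real.sqrt k := by gcongr
    _ = (Real.sqrt k * Real.sqrt k) / k * Real.sqrt (∑ b, w j b ^ 2) := by ring
    _ = Real.sqrt (∑ b, w j b ^ 2) := by rw [h3, div_self hk.ne', one_mul]
    _ ≤ _ := h1

end PairwiseLearning

/-! ### Excess risk and the error of the centered weights -/

namespace PairwiseLearning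

variable {n k : ℕ} [NeZero k] (M : PairwiseModel n k) {lam : ℝ}

/-- The logistic loss of `w` at the configuration `z`. -/
noncomputable def logLoss (i : Fin n) (α : Fin k) (w : Matrix (Fin n) (Fin k) ℝ)
    (z : Fin n → Fin k) : ℝ :=
  softplus (-(label i α z * predictor i w z))

theorem logLoss_of_eq {i : Fin n} {α : Fin k} (w : Matrix (Fin n) (Fin k) ℝ)
    {z : Fin n → Fin k} (h : z i = α) : logLoss i α w z = softplus (-predictor i w z) := by
  simp [logLoss, label, h]

theorem logLoss_of_ne {i : Fin n} {α : Fin k} (w : Matrix (Fin n) (Fin k) ℝ)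
    {z : Fin n → Fin k} (h : z i ≠ α) : logLoss i α w z = softplus (predictor i w z) := by
  simp [logLoss, label, h]

theorem sum_filter_or (i : Fin n) {α β : Fin k} (h : α ≠ β) (F : (Fin n → Fin k) → ℝ) :
    ∑ z with (z i = α ∨ z i = β), F z = ∑ z with z i = α, F z + ∑ z with z i = β, F z := by
  rw [Finset.filter_or, Finset.sum_union]
  rw [Finset.disjoint_filter]
  intro z _ h1 h2
  exact h (h1.symm.trans h2)

theorem mass_update_eq_exp_mul (i : Fin n) {α β : Fin k} {z : Fin n → Fin k} (hz : z i = α) :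
    M.mass (Function.update z i β)
      = Real.exp (-predictor i (trueWeights M i α β) z) * M.mass z := by
  rw [M.mass_update i z β α, predictor_trueWeights, neg_sub]
  congr 2
  rw [← hz, Function.update_eq_self]

/-- Sums over the pair event, as sums over the event that the variable has the first symbol. -/
theorem sum_pair_mass_mul (i : Fin n) {α β : Fin k} (h : α ≠ β) (F : (Fin n → Fin k) → ℝ) :
    ∑ z with (z i = α ∨ z i = β), M.mass z * F z
      = ∑ z with z i = α, M.mass z * (F z + Real.exp (-predictor i (trueWeights M i α β) z)
          * F (Function.update z i β)) := by
  rw [sum_filter_or i h, sum_filter_eq_sum_update i β α, ← Finset.sum_add_distrib]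
  refine Finset.sum_congr rfl fun z hz => ?_
  rw [mass_update_eq_exp_mul M i (Finset.mem_filter.1 hz).2]
  ring

theorem one_add_exp_neg_mul_sigmoid (a : ℝ) : (1 + Real.exp (-a)) * Real.sigmoid a = 1 := by
  rw [Real.sigmoid_def]
  exact mul_inv_cancel₀ (by positivity)

/-- The excess population risk is the mean of a Bregman divergence. -/
theorem sum_pair_excess (i : Fin n) {α β : Fin k} (h : α ≠ β)
    (w : Matrix (Fin n) (Fin k) ℝ) :
    ∑ z with (z i = α ∨ z i = β),
        M.mass z * (logLoss i α w z - logLoss i α (trueWeights M i α β) z)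
      = ∑ z with z i = α, M.mass z * ((1 + Real.exp (-predictor i (trueWeights M i α β) z)) *
          softplusBregman (predictor i (trueWeights M i α β) z) (predictor i w z)) := by
  rw [sum_pair_mass_mul M i h]
  refine Finset.sum_congr rfl fun z hz => ?_
  have hz : z i = α := (Finset.mem_filter.1 hz).2
  have hz' : Function.update z i β i ≠ α := by simpa using h.symm
  rw [logLoss_of_eq _ hz, logLoss_of_eq _ hz, logLoss_of_ne _ hz', logLoss_of_ne _ hz',
    predictor_update_self, predictor_update_self]
  set a := predictor i (trueWeights M i α β) z
  set u := predictor i w z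
  -- The configuration with `z i = α` has weight `1` and its flip to `β` has weight `e^{-a}`. As
  -- `softplus (-u) = softplus u - u`, the linear part of the total is `-(u - a)`, which this
  -- identity matches with that of the Bregman divergence.
  have h1 := one_add_exp_neg_mul_sigmoid a
  have h2 := softplus_eq_add_softplus_neg u
  have h3 := softplus_eq_add_softplus_neg a
  unfold softplusBregman
  have h4 : (1 + Real.exp (-a)) * (softplus u - softplus a - Real.sigmoid a * (u - a))
      = (1 + Real.exp (-a)) * (softplus u - softplus a)
        - ((1 + Real.exp (-a)) * Real.sigmoid a) * (u - a) := by ring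
  rw [h4, h1]
  congr 1
  linarith

/-- The factor `1 + e^{-a}` is the relative mass of a configuration together with its flip. This
form serves the quadratic bound; the one over `z i = α` serves the linear bound, where `1 + e^{-a}`
cancels a sigmoid. -/
theorem sum_pair_excess' (i : Fin n) {α β : Fin k} (h : α ≠ β)
    (w : Matrix (Fin n) (Fin k) ℝ) :
    ∑ z with (z i = α ∨ z i = β),
        M.mass z * (logLoss i α w z - logLoss i α (trueWeights M i α β) z)
      = ∑ z with (z i = α ∨ z i = β), M.mass z *
          softplusBregman (predictor i (trueWeights M i α β) z) (predictor i w z) := by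
  rw [sum_pair_excess M i h, sum_pair_mass_mul M i h]
  refine Finset.sum_congr rfl fun z _ => ?_
  rw [predictor_update_self, predictor_update_self]
  ring

theorem one_le_mul_sum_mass (hl : M.width ≤ lam) (j : Fin n) (a : Fin k) :
    1 ≤ k * Real.exp (2 * lam) * ∑ z with z j = a, M.mass z := by
  have := sum_mass_update_le M hl j a (H := fun _ => 1) (fun _ => zero_le_one)
  simpa [M.sum_mass] using this

theorem min_abs_sq_mono {s t : ℝ} (h : |s| ≤ |t|) : min |s| (s ^ 2) ≤ min |t| (t ^ 2) :=
  min_le_min h (sq_le_sq.2 h)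

/-- `min |t| (t ^ 2)` is not convex, so monotonicity is used instead: half the difference is at most
the larger of `|p|`, `|q|`. -/
theorem min_abs_sq_half_sub_le (p q : ℝ) :
    min |(p - q) / 2| (((p - q) / 2) ^ 2) ≤ min |p| (p ^ 2) + min |q| (q ^ 2) := by
  have hp : 0 ≤ min |p| (p ^ 2) := le_min (abs_nonneg _) (sq_nonneg _)
  have hq : 0 ≤ min |q| (q ^ 2) := le_min (abs_nonneg _) (sq_nonneg _)
  have h : |(p - q) / 2| ≤ (|p| + |q|) / 2 := by
    rw [abs_div, abs_two]
    exact div_le_div_of_nonneg_right (abs_sub _ _) zero_le_two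
  rcases le_total |p| |q| with h1 | h1
  · have := min_abs_sq_mono (s := (p - q) / 2) (t := q) (by linarith)
    linarith
  · have := min_abs_sq_mono (s := (p - q) / 2) (t := p) (by linarith)
    linarith

/-- The centered value is the average of the differences `v b - v c`. It reduces a centered error to
a comparison of two symbols. -/
theorem exists_abs_sub_mean_le (v : Fin k → ℝ) (b : Fin k) :
    ∃ c, |v b - (1 / (k : ℝ)) * ∑ a, v a| ≤ |v b - v c| := by
  by_contra! hcon
  have hk : 0 < (k : ℝ) := Nat.cast_pos.2 (NeZero.pos k)
  have e : ∑ a, (v b - v a) = k * (v b - (1 / (k : ℝ)) * ∑ a, v a) := by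
    rw [Finset.sum_sub_distrib, mul_sub, ← mul_assoc]
    simp [hk.ne']
  have h1 : ∑ a : Fin k, |v b - v a| < ∑ a : Fin k, |v b - (1 / (k : ℝ)) * ∑ a, v a| :=
    Finset.sum_lt_sum_of_nonempty Finset.univ_nonempty fun c _ => hcon c
  have h2 := Finset.abs_sum_le_sum_abs (fun a => v b - v a) Finset.univ
  rw [e, abs_mul, abs_of_pos hk] at h2
  simp only [Finset.sum_const, Finset.card_univ, Fintype.card_fin, nsmul_eq_mul] at h1
  linarith

/-- The excess risk controls the recovery of the centered weights quadratically for small errors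
and linearly for large ones. -/
theorem sum_mass_mul_min_le (hl : M.width ≤ lam) {i j : Fin n} (hij : j ≠ i) {α β : Fin k}
    (h : α ≠ β) (w : Matrix (Fin n) (Fin k) ℝ) (b : Fin k) {U : ℝ}
    (hU : U = (w j b - trueWeights M i α β j b)
      - (1 / (k : ℝ)) * ∑ a, (w j a - trueWeights M i α β j a)) :
    min |U / 2| ((U / 2) ^ 2) * ∑ z with (z i = α ∨ z i = β), M.mass z
      ≤ 64 * k * Real.exp (4 * lam) * ∑ z with (z i = α ∨ z i = β),
        M.mass z * (logLoss i α w z - logLoss i α (trueWeights M i α β) z) := by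
  set ws := trueWeights M i α β with hws
  set φ : ℝ → ℝ := fun t => min |t| (t ^ 2) with hφ
  have hφ0 : ∀ t, 0 ≤ φ t := fun t => le_min (abs_nonneg _) (sq_nonneg _)
  obtain ⟨c, hc⟩ := exists_abs_sub_mean_le (fun a => w j a - ws j a) b
  set D : (Fin n → Fin k) → ℝ := fun z => predictor i w z - predictor i ws z with hD
  set H : (Fin n → Fin k) → ℝ := fun z => if z i = α ∨ z i = β then φ (D z) else 0 with hH
  have hH0 : ∀ z, 0 ≤ H z := fun z => by
    simp only [hH]; split_ifs <;> simp [hφ0]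
  have hm : ∀ z, 0 ≤ M.mass z := fun z => (M.mass_pos z).le
  have hsub : ∀ a, ∑ z with z j = a, M.mass z * H z
      ≤ ∑ z with (z i = α ∨ z i = β), M.mass z * φ (D z) := fun a => by
    have : ∑ z with (z i = α ∨ z i = β), M.mass z * φ (D z) = ∑ z, M.mass z * H z := by
      rw [Finset.sum_filter]
      refine Finset.sum_congr rfl fun z _ => ?_
      simp only [hH]; split_ifs <;> simp
    rw [this]
    exact Finset.sum_le_sum_of_subset_of_nonneg (Finset.filter_subset _ _)
      fun z _ _ => mul_nonneg (hm z) (hH0 z)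
  have hb := sum_mass_update_le M hl j b hH0
  have hc' := sum_mass_update_le M hl j c hH0
  -- Setting `z j` to `b` and to `c` gives values of `D` at distance at least `|U|`, so one of them
  -- is at least `|U| / 2` in absolute value.
  have hlow : min |U / 2| ((U / 2) ^ 2) * ∑ z with (z i = α ∨ z i = β), M.mass z
      ≤ ∑ z, M.mass z * H (Function.update z j b) + ∑ z, M.mass z * H (Function.update z j c) := by
    rw [← Finset.sum_add_distrib, Finset.mul_sum, Finset.sum_filter]
    refine Finset.sum_le_sum fun z _ => ?_
    simp only [hH, Function.update_of_ne hij.symm]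
    split_ifs with hz
    · rw [← mul_add, mul_comm]
      refine mul_le_mul_of_nonneg_left ?_ (hm z)
      simp only [hD, predictor_update hij]
      refine le_trans ?_ (min_abs_sq_half_sub_le _ _)
      apply min_abs_sq_mono
      rw [abs_div, abs_div]
      refine div_le_div_of_nonneg_right ?_ (abs_nonneg _)
      rw [hU]
      refine hc.trans (le_of_eq ?_)
      congr 1
      ring
    · simp
  -- The true logit is at most `2λ` in absolute value. This curvature loss and the resampling cost,
  -- `e^{2λ}` each, make up the `e^{4λ}`.
  have hreg : Real.exp (-(2 * lam)) / 32 *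
      ∑ z with (z i = α ∨ z i = β), M.mass z * φ (D z)
      ≤ ∑ z with (z i = α ∨ z i = β),
        M.mass z * (logLoss i α w z - logLoss i α ws z) := by
    rw [hws, sum_pair_excess' M i h, Finset.mul_sum]
    refine Finset.sum_le_sum fun z _ => ?_
    rw [mul_left_comm]
    refine mul_le_mul_of_nonneg_left ?_ (hm z)
    refine le_trans ?_ (softplusBregman_ge _ _)
    refine mul_le_mul_of_nonneg_right ?_ (hφ0 _)
    have := abs_predictor_trueWeights_le M hl i α β z
    gcongr
  set E := ∑ z with (z i = α ∨ z i = β), M.mass z * (logLoss i α w z - logLoss i α ws z)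
  set Φ := ∑ z with (z i = α ∨ z i = β), M.mass z * φ (D z)
  have e1 : Real.exp (2 * lam) * Real.exp (-(2 * lam)) = 1 := by
    rw [← Real.exp_add]; simp
  have e2 : Real.exp (4 * lam) = Real.exp (2 * lam) * Real.exp (2 * lam) := by
    rw [← Real.exp_add]; ring_nf
  have hΦ : Φ ≤ 32 * Real.exp (2 * lam) * E := by
    have := mul_le_mul_of_nonneg_left hreg (by positivity : 0 ≤ 32 * Real.exp (2 * lam))
    refine le_trans (le_of_eq ?_) this
    rw [show 32 * Real.exp (2 * lam) * (Real.exp (-(2 * lam)) / 32 * Φ)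
      = Real.exp (2 * lam) * Real.exp (-(2 * lam)) * Φ by ring, e1, one_mul]
  have hK : 0 ≤ (k : ℝ) * Real.exp (2 * lam) := by positivity
  calc _ ≤ k * Real.exp (2 * lam) * Φ + k * Real.exp (2 * lam) * Φ :=
        hlow.trans (add_le_add (hb.trans (mul_le_mul_of_nonneg_left (hsub b) hK))
          (hc'.trans (mul_le_mul_of_nonneg_left (hsub c) hK)))
    _ ≤ k * Real.exp (2 * lam) * (32 * Real.exp (2 * lam) * E)
        + k * Real.exp (2 * lam) * (32 * Real.exp (2 * lam) * E) := by gcongr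
    _ = _ := by rw [e2]; ring

end PairwiseLearning

/-! ### Large errors: perturbing one entry of the minimizer -/

namespace PairwiseLearning

variable {n k : ℕ}

/-- The matrix `w` with its entry `(j, b)` replaced by `c`. -/
def setEntry (w : Matrix (Fin n) (Fin k) ℝ) (j : Fin n) (b : Fin k) (c : ℝ) :
    Matrix (Fin n) (Fin k) ℝ :=
  Matrix.of fun l a => if l = j ∧ a = b then c else w l a

theorem setEntry_self (w : Matrix (Fin n) (Fin k) ℝ) (j : Fin n) (b : Fin k) (c : ℝ) :
    setEntry w j b c j b = c := by
  simp [setEntry]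

theorem setEntry_neg (w : Matrix (Fin n) (Fin k) ℝ) (j : Fin n) (b : Fin k) (c : ℝ) :
    setEntry (-w) j b c = -setEntry w j b (-c) := by
  ext l a
  simp only [setEntry, Matrix.of_apply, Matrix.neg_apply]
  split_ifs <;> simp

theorem norm21_neg (w : Matrix (Fin n) (Fin k) ℝ) : norm21 (-w) = norm21 w := by
  simp [norm21]

theorem norm21_setEntry_le (w : Matrix (Fin n) (Fin k) ℝ) (j : Fin n) (b : Fin k) {c : ℝ}
    (hc : |c| ≤ |w j b|) : norm21 (setEntry w j b c) ≤ norm21 w := by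
  unfold norm21
  refine Finset.sum_le_sum fun l _ => Real.sqrt_le_sqrt (Finset.sum_le_sum fun a _ => ?_)
  simp only [setEntry, Matrix.of_apply]
  split_ifs with h
  · rw [h.1, h.2]
    exact sq_le_sq.2 hc
  · exact le_rfl

variable [NeZero k] (M : PairwiseModel n k) {lam : ℝ}

theorem predictor_setEntry {i j : Fin n} (hij : j ≠ i) (w : Matrix (Fin n) (Fin k) ℝ)
    {b : Fin k} (c : ℝ) {z : Fin n → Fin k} (hz : z j = b) :
    predictor i (setEntry w j b c) z = predictorRest i j w z + c := by
  rw [predictor_eq_rest_add hij, hz, setEntry_self]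
  congr 1
  unfold predictorRest
  refine Finset.sum_congr rfl fun l hl => ?_
  simp [setEntry, Finset.ne_of_mem_erase hl]

theorem sum_filter_and_eq {S : (Fin n → Fin k) → Prop} [DecidablePred S]
    {Q : (Fin n → Fin k) → Prop} [DecidablePred Q] (p F : (Fin n → Fin k) → ℝ) :
    ∑ z with (S z ∧ Q z), p z * F z = ∑ z with S z, p z * if Q z then F z else 0 := by
  rw [Finset.sum_filter, Finset.sum_filter]
  refine Finset.sum_congr rfl fun z _ => ?_
  by_cases h1 : S z <;> by_cases h2 : Q z <;> simp [h1, h2]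

/-- If lowering a large entry `w j b` does not decrease the local risk much, then the remaining
part of the predictor must compensate that entry with a noticeable probability. -/
theorem local_risk_ge (hl : M.width ≤ lam) {i j : Fin n} (hij : j ≠ i) {α β : Fin k}
    (h : α ≠ β) (w : Matrix (Fin n) (Fin k) ℝ) (b : Fin k) {T : ℝ} (hT : 16 ≤ T)
    (hTl : 4 * lam ≤ T) (hw : 7 / 8 * T ≤ w j b) :
    T / 16 * ∑ z with z i = β, M.mass z * (if z j = b then 1 else 0)
      ≤ ∑ z with ((z i = α ∨ z i = β) ∧ z j = b),
          M.mass z * (logLoss i α w z - logLoss i α (setEntry w j b (w j b - T / 4)) z)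
        + 5 * T / 16 * Real.exp (2 * lam) * ∑ z with z i = α,
          M.mass z * (if z j = b ∧ predictorRest i j w z < -(T / 8) then 1 else 0) := by
  have hm : ∀ z, 0 ≤ M.mass z := fun z => (M.mass_pos z).le
  set XA : (Fin n → Fin k) → ℝ :=
    fun z => if z j = b ∧ predictorRest i j w z < -(T / 8) then 1 else 0 with hXA
  set XN : (Fin n → Fin k) → ℝ :=
    fun z => if z j = b ∧ ¬ predictorRest i j w z < -(T / 8) then 1 else 0 with hXN
  have hA0 : ∀ z, 0 ≤ XA z := fun z => by simp only [hXA]; split_ifs <;> norm_num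
  have hN0 : ∀ z, 0 ≤ XN z := fun z => by simp only [hXN]; split_ifs <;> norm_num
  have hAu : ∀ z a, XA (Function.update z i a) = XA z := fun z a => by
    simp only [hXA, Function.update_of_ne hij, predictorRest_update_self]
  have hNu : ∀ z a, XN (Function.update z i a) = XN z := fun z a => by
    simp only [hXN, Function.update_of_ne hij, predictorRest_update_self]
  have h1 := sum_filter_mass_update_le M hl i β α hN0
  have h2 := sum_filter_mass_update_le M hl i α β hA0
  simp only [hAu, hNu] at h1 h2
  have hsplit : ∑ z with z i = β, M.mass z * (if z j = b then (1 : ℝ) else 0)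
      = ∑ z with z i = β, M.mass z * XA z + ∑ z with z i = β, M.mass z * XN z := by
    rw [← Finset.sum_add_distrib]
    refine Finset.sum_congr rfl fun z _ => ?_
    rw [← mul_add]
    congr 1
    simp only [hXA, hXN]
    by_cases h1 : z j = b <;> by_cases h2 : predictorRest i j w z < -(T / 8) <;> simp [h1, h2]
  -- For label `α` the loss grows by at most `T/4`, and if the rest is at least `-T/8` by at most
  -- `e^{-T/2}`, the lowered predictor being at least `7T/8 - T/8 - T/4 = T/2`. For label `β` it
  -- never grows, and in the latter case it drops by at least `T/8`, half of `T/4`.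
  have hloc : -(T / 4) * ∑ z with z i = α, M.mass z * XA z
        - Real.exp (-(T / 2)) * ∑ z with z i = α, M.mass z * XN z
        + T / 8 * ∑ z with z i = β, M.mass z * XN z
      ≤ ∑ z with ((z i = α ∨ z i = β) ∧ z j = b),
          M.mass z * (logLoss i α w z - logLoss i α (setEntry w j b (w j b - T / 4)) z) := by
    rw [sum_filter_and_eq, sum_filter_or i h, Finset.mul_sum, Finset.mul_sum, Finset.mul_sum,
      ← Finset.sum_sub_distrib]
    refine add_le_add (Finset.sum_le_sum fun z hz => ?_) (Finset.sum_le_sum fun z hz => ?_)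
    · have hz : z i = α := (Finset.mem_filter.1 hz).2
      rw [mul_left_comm, mul_left_comm (Real.exp _), ← mul_sub]
      refine mul_le_mul_of_nonneg_left ?_ (hm z)
      simp only [hXA, hXN]
      by_cases hb : z j = b
      · rw [logLoss_of_eq _ hz, logLoss_of_eq _ hz, predictor_setEntry hij w _ hb,
          predictor_eq_rest_add hij, hb]
        by_cases hR : predictorRest i j w z < -(T / 8)
        · simp only [hR, not_true_eq_false, and_false, and_true, if_true, if_false]
          have := softplus_sub_le (x := -(predictorRest i j w z + w j b))
            (y := -(predictorRest i j w z + (w j b - T / 4))) (by linarith)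
          linarith
        · simp only [hR, not_false_eq_true, and_false, and_true, if_true, if_false]
          have h3 := softplus_nonneg (-(predictorRest i j w z + w j b))
          have h4 := softplus_le_exp (-(predictorRest i j w z + (w j b - T / 4)))
          have h5 : Real.exp (-(predictorRest i j w z + (w j b - T / 4)))
              ≤ Real.exp (-(T / 2)) := Real.exp_le_exp.2 (by push Not at hR; linarith)
          linarith
      · simp [hb]
    · have hz : z i ≠ α := by
        rw [(Finset.mem_filter.1 hz).2]; exact h.symm
      rw [mul_left_comm]
      refine mul_le_mul_of_nonneg_left ?_ (hm z)
      simp only [hXN]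
      by_cases hb : z j = b
      · rw [logLoss_of_ne _ hz, logLoss_of_ne _ hz, predictor_setEntry hij w _ hb,
          predictor_eq_rest_add hij, hb]
        by_cases hR : predictorRest i j w z < -(T / 8)
        · simp only [hR, not_true_eq_false, and_false, if_true, if_false]
          have := softplus_mono (x := predictorRest i j w z + (w j b - T / 4))
            (y := predictorRest i j w z + w j b) (by linarith)
          linarith
        · simp only [hR, not_false_eq_true, and_true, if_true]
          have := softplus_sub_ge_half (u := predictorRest i j w z + w j b) (τ := T / 4)
            (by linarith) (by push Not at hR; linarith)
          rw [add_sub_assoc] at this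
          linarith
      · simp [hb]
  set αA := ∑ z with z i = α, M.mass z * XA z
  set αN := ∑ z with z i = α, M.mass z * XN z
  set βA := ∑ z with z i = β, M.mass z * XA z
  set βN := ∑ z with z i = β, M.mass z * XN z
  have hβN : 0 ≤ βN := Finset.sum_nonneg fun z _ => mul_nonneg (hm z) (hN0 z)
  have he : Real.exp (-(T / 2)) * Real.exp (2 * lam) ≤ T / 16 := by
    rw [← Real.exp_add]
    have : Real.exp (-(T / 2) + 2 * lam) ≤ 1 := Real.exp_le_one_iff.2 (by linarith)
    linarith
  have h3 : Real.exp (-(T / 2)) * αN ≤ T / 16 * βN := by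
    calc _ ≤ Real.exp (-(T / 2)) * (Real.exp (2 * lam) * βN) :=
          mul_le_mul_of_nonneg_left h1 (Real.exp_pos _).le
      _ = Real.exp (-(T / 2)) * Real.exp (2 * lam) * βN := by ring
      _ ≤ _ := mul_le_mul_of_nonneg_right he hβN
  have h4 : T / 16 * βA ≤ T / 16 * (Real.exp (2 * lam) * αA) :=
    mul_le_mul_of_nonneg_left h2 (by linarith)
  have h5 : 1 ≤ Real.exp (2 * lam) :=
    Real.one_le_exp (by linarith [M.width_nonneg])
  have hαA : 0 ≤ αA := Finset.sum_nonneg fun z _ => mul_nonneg (hm z) (hA0 z)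
  have h6 : T / 4 * αA ≤ T / 4 * Real.exp (2 * lam) * αA := by
    rw [mul_assoc]
    refine mul_le_mul_of_nonneg_left ?_ (by linarith)
    nlinarith
  rw [hsplit]
  linarith

/-- A predictor which is very negative apart from the variable `j` has a large excess risk. -/
theorem excess_ge_of_rest (hl : M.width ≤ lam) {i j : Fin n} (hij : j ≠ i) {α β : Fin k}
    (h : α ≠ β) (w : Matrix (Fin n) (Fin k) ℝ) (b : Fin k) {T : ℝ}
    (hT : 128 * lam + 32 ≤ T) (hw : |(1 / (k : ℝ)) * ∑ a, w j a| ≤ 2 * lam) :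
    k * T * ∑ z with z i = α,
        M.mass z * (if z j = b ∧ predictorRest i j w z < -(T / 8) then 1 else 0)
      ≤ 16 * Real.exp (2 * lam) * ∑ z with (z i = α ∨ z i = β),
        M.mass z * (logLoss i α w z - logLoss i α (trueWeights M i α β) z) := by
  have hm : ∀ z, 0 ≤ M.mass z := fun z => (M.mass_pos z).le
  have hk : 0 < (k : ℝ) := Nat.cast_pos.2 (NeZero.pos k)
  have hl0 : 0 ≤ lam := M.width_nonneg.trans hl
  set ws := trueWeights M i α β with hws
  set D : (Fin n → Fin k) → ℝ := fun z => predictor i w z - predictor i ws z with hD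
  -- A nonnegative truncation of the linear lower bound for the divergence, as resampling requires a
  -- nonnegative function.
  set H : (Fin n → Fin k) → ℝ := fun z =>
    if z i = α ∧ predictorRest i j w z < -(T / 8) then max 0 (-D z - (4 * lam + 2)) else 0 with hH
  have hH0 : ∀ z, 0 ≤ H z := fun z => by
    simp only [hH]; split_ifs <;> simp
  have hup : ∑ z, M.mass z * H z ≤ ∑ z with (z i = α ∨ z i = β),
        M.mass z * (logLoss i α w z - logLoss i α ws z) := by
    rw [hws, sum_pair_excess M i h, Finset.sum_filter]
    refine Finset.sum_le_sum fun z _ => ?_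
    have hB : 0 ≤ (1 + Real.exp (-predictor i (trueWeights M i α β) z)) *
        softplusBregman (predictor i (trueWeights M i α β) z) (predictor i w z) :=
      mul_nonneg (by positivity) (softplusBregman_nonneg _ _)
    by_cases hz : z i = α
    · rw [if_pos hz]
      refine mul_le_mul_of_nonneg_left ?_ (hm z)
      simp only [hH, hz, true_and]
      split_ifs
      · refine max_le hB (le_trans ?_ (softplusBregman_mul_ge _ _))
        have := abs_predictor_trueWeights_le M hl i α β z
        simp only [hD]
        linarith
      · exact hB
    · simp [hH, hz]
  -- The sum over all targets `c` fills disjoint fibres, so it costs `e^{2λ}` and no factor `k`.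
  have hlow : ∑ z with z j = b, ∑ c, M.mass z * H (Function.update z j c)
      ≤ Real.exp (2 * lam) * ∑ z, M.mass z * H z := by
    rw [← Finset.sum_fiberwise Finset.univ (fun z => z j), Finset.mul_sum, Finset.sum_comm]
    exact Finset.sum_le_sum fun c _ => sum_filter_mass_update_le M hl j c b hH0
  -- Summed over `c`, row `j` contributes at most `2λk` to the predictor and the true logits at
  -- least `-2λk`. What remains is `k (T/8 - 8λ - 2) ≥ k T / 16`, which is the lower bound imposed
  -- on `T`.
  have hpt : k * T / 16 * ∑ z with z i = α,
        M.mass z * (if z j = b ∧ predictorRest i j w z < -(T / 8) then 1 else 0)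
      ≤ ∑ z with z j = b, ∑ c, M.mass z * H (Function.update z j c) := by
    rw [Finset.sum_filter, Finset.sum_filter, Finset.mul_sum]
    refine Finset.sum_le_sum fun z _ => ?_
    have hnn : 0 ≤ ∑ c, M.mass z * H (Function.update z j c) :=
      Finset.sum_nonneg fun c _ => mul_nonneg (hm z) (hH0 _)
    by_cases hz : z i = α
    · by_cases hb : z j = b
      · by_cases hR : predictorRest i j w z < -(T / 8)
        · simp only [hz, hb, hR, and_self, if_true]
          rw [← Finset.mul_sum, mul_one, mul_comm]
          refine mul_le_mul_of_nonneg_left ?_ (hm z)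
          have hc : ∀ c, -(predictorRest i j w z + w j c - predictor i ws (Function.update z j c))
              - (4 * lam + 2) ≤ H (Function.update z j c) := fun c => by
            simp only [hH, Function.update_of_ne hij.symm, hz, predictorRest_update, hR,
              and_self, if_true, hD, predictor_update hij w]
            exact le_max_right _ _
          refine le_trans ?_ (Finset.sum_le_sum fun c _ => hc c)
          have hs : ∑ c, predictor i ws (Function.update z j c) ≥ -(k * (2 * lam)) := by
            have : ∑ c : Fin k, -(2 * lam) ≤ ∑ c, predictor i ws (Function.update z j c) :=
              Finset.sum_le_sum fun c _ => (abs_le.1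
                (abs_predictor_trueWeights_le M hl i α β (Function.update z j c))).1
            simp only [Finset.sum_const, Finset.card_univ, Fintype.card_fin, nsmul_eq_mul] at this
            linarith
          have hw2 : ∑ a, w j a ≤ k * (2 * lam) := by
            have := (abs_le.1 hw).2
            rw [one_div, inv_mul_le_iff₀ hk] at this
            exact this
          simp only [Finset.sum_sub_distrib, Finset.sum_neg_distrib, Finset.sum_add_distrib,
            Finset.sum_const, Finset.card_univ, Fintype.card_fin, nsmul_eq_mul]
          have h3 : (k : ℝ) * predictorRest i j w z ≤ k * -(T / 8) :=
            mul_le_mul_of_nonneg_left hR.le hk.le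
          have h4 : (k : ℝ) * (128 * lam + 32) ≤ k * T := mul_le_mul_of_nonneg_left hT hk.le
          linarith
        · simpa [hz, hb, hR] using hnn
      · simp [hb]
    · by_cases hb : z j = b
      · simpa [hz, hb] using hnn
      · simp [hz, hb]
  have := (hpt.trans hlow).trans (mul_le_mul_of_nonneg_left hup (Real.exp_pos (2 * lam)).le)
  linarith

end PairwiseLearning

/-! ### From risk bounds to the error bound -/

namespace PairwiseLearning

/-- Here `s = √k` and `Λ = e^λ`. Since `s Λ √PS ≥ 1`, the hypotheses give `Λ² min(T/2, T²/4) ≤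
ε²/1000`. The quadratic branch contradicts `ε < T`; the linear one forces `ε` to be large. -/
theorem error_large_of_risk_le {k s Λ PS T δ ε E : ℝ} (hk : 1 ≤ k) (hs1 : 1 ≤ s)
    (hs2 : s * s = k) (hΛ1 : 1 ≤ Λ) (hT0 : 0 < T) (hε : 0 < ε) (hcon : ε < T) (hPS : 0 < PS)
    (hPS1 : 1 ≤ k * Λ ^ 2 * PS)
    (hδε : 64000 * (δ * (k * s * Λ ^ 7)) ≤ ε ^ 2)
    (hA : min |T / 2| ((T / 2) ^ 2) * PS ≤ 64 * k * Λ ^ 4 * E)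
    (hglob : E ≤ δ * Real.sqrt PS) : 500 * Λ ^ 2 < ε := by
  have hΛ0 : 0 < Λ := by linarith
  have hσ : 0 < Real.sqrt PS := Real.sqrt_pos.2 hPS
  have hσσ : Real.sqrt PS * Real.sqrt PS = PS := Real.mul_self_sqrt hPS.le
  have h1 : 1 ≤ s * Λ * Real.sqrt PS := by
    have h2 : 1 ≤ (s * Λ * Real.sqrt PS) ^ 2 := by
      rw [show (s * Λ * Real.sqrt PS) ^ 2 = (s * s) * Λ ^ 2 * (Real.sqrt PS * Real.sqrt PS) by
        ring, hs2, hσσ]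
      exact hPS1
    exact (one_le_sq_iff₀ (by positivity)).1 h2
  set μ := min |T / 2| ((T / 2) ^ 2) with hμ
  have hμ0 : 0 ≤ μ := le_min (abs_nonneg _) (sq_nonneg _)
  have h2 : μ * Real.sqrt PS ≤ 64 * k * Λ ^ 4 * δ := by
    have h3 : μ * PS ≤ 64 * k * Λ ^ 4 * (δ * Real.sqrt PS) :=
      hA.trans (mul_le_mul_of_nonneg_left hglob (by positivity))
    rw [← hσσ] at h3
    refine le_of_mul_le_mul_right ?_ hσ
    rw [Real.sqrt_mul_self hσ.le] at h3
    linarith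
  have h4 : Λ ^ 2 * μ ≤ ε ^ 2 / 1000 := by
    calc Λ ^ 2 * μ = Λ ^ 2 * μ * 1 := by ring
      _ ≤ Λ ^ 2 * μ * (s * Λ * Real.sqrt PS) :=
          mul_le_mul_of_nonneg_left h1 (by positivity)
      _ = s * Λ ^ 3 * (μ * Real.sqrt PS) := by ring
      _ ≤ s * Λ ^ 3 * (64 * k * Λ ^ 4 * δ) := mul_le_mul_of_nonneg_left h2 (by positivity)
      _ = 64000 * (δ * (k * s * Λ ^ 7)) / 1000 := by ring
      _ ≤ _ := by gcongr
  rcases min_choice |T / 2| ((T / 2) ^ 2) with h5 | h5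
  · rw [hμ, h5, abs_of_pos (by linarith)] at h4
    have h6 : Λ ^ 2 * (ε / 2) < ε ^ 2 / 1000 :=
      lt_of_lt_of_le (mul_lt_mul_of_pos_left (by linarith) (by positivity)) h4
    have h7 : ε * (500 * Λ ^ 2) < ε * ε := by linarith
    exact lt_of_mul_lt_mul_left h7 hε.le
  · exfalso
    rw [hμ, h5] at h4
    have h6 : 1 * (T / 2) ^ 2 ≤ Λ ^ 2 * (T / 2) ^ 2 :=
      mul_le_mul_of_nonneg_right (one_le_pow₀ hΛ1) (sq_nonneg _)
    have h7 : ε ^ 2 < T ^ 2 := pow_lt_pow_left₀ hcon hε.le two_ne_zero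
    linarith

/-- `hB` bounds the mass `π` of label `β` with `z j = b` by a multiple of `αA`, `hC` bounds `αA` by
the excess risk. Combined they give `T ≲ Λ⁸ √k δ`, hence `200 k ≤ Λ ε`; with `ε ≤ 6λ√k` this makes
`ε` of order at most `Λ²`, against `large`. -/
theorem error_le_of_large {k s Λ lam PS PSb Pα Pβ Pb π αA T δ ε E : ℝ} (hk : 1 ≤ k) (hs1 : 1 ≤ s)
    (hs2 : s * s = k) (hΛ1 : 1 ≤ Λ) (hl0 : 0 ≤ lam) (hΛq : 1 + lam + lam ^ 2 / 2 ≤ Λ)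
    (hε : 0 < ε) (hcon : ε < T) (hPβ : 0 < Pβ)
    (hSum : PS = Pα + Pβ) (hSb : PSb = Pb + π) (hPβ1 : 1 ≤ k * Λ ^ 2 * Pβ)
    (hαβ : Pα ≤ Λ ^ 2 * Pβ) (hαβb : Pb ≤ Λ ^ 2 * π) (hβb : Pβ ≤ k * Λ ^ 2 * π)
    (hδ : 0 ≤ δ) (hδε : 64000 * (δ * (k * s * Λ ^ 7)) ≤ ε ^ 2)
    (hTs : T ≤ 6 * lam * s) (large : 500 * Λ ^ 2 < ε)
    (hB : T / 16 * π ≤ δ * Real.sqrt PSb + 5 * T / 16 * Λ ^ 2 * αA)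
    (hC : k * T * αA ≤ 16 * Λ ^ 2 * E) (hglob : E ≤ δ * Real.sqrt PS) : False := by
  have hΛ0 : 0 < Λ := by linarith
  have hT0 : 0 < T := hε.trans hcon
  have hπ : 0 < π := by
    by_contra! hneg
    have : k * Λ ^ 2 * π ≤ 0 := mul_nonpos_of_nonneg_of_nonpos (by positivity) hneg
    linarith
  have hπ1 : 1 ≤ k ^ 2 * Λ ^ 4 * π := by
    calc 1 ≤ k * Λ ^ 2 * Pβ := hPβ1
      _ ≤ k * Λ ^ 2 * (k * Λ ^ 2 * π) := mul_le_mul_of_nonneg_left hβb (by positivity)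
      _ = _ := by ring
  have hΛ2 : 1 ≤ Λ ^ 2 := one_le_pow₀ hΛ1
  have hsqrtb : Real.sqrt PSb ≤ 2 * Λ ^ 3 * k * π := by
    apply Real.sqrt_le_iff.2 ⟨by positivity, ?_⟩
    have h1 : PSb ≤ 2 * Λ ^ 2 * π := by
      have := le_mul_of_one_le_left hπ.le hΛ2
      rw [hSb]; linarith
    have h2 : 0 ≤ 2 * Λ ^ 2 * π := by positivity
    calc PSb ≤ 2 * Λ ^ 2 * π * 1 := by linarith
      _ ≤ 2 * Λ ^ 2 * π * (k ^ 2 * Λ ^ 4 * π) := mul_le_mul_of_nonneg_left hπ1 h2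
      _ ≤ 4 * (Λ ^ 2 * π * (k ^ 2 * Λ ^ 4 * π)) := by
          have : 0 ≤ Λ ^ 2 * π * (k ^ 2 * Λ ^ 4 * π) := by positivity
          linarith
      _ = _ := by ring
  have hεT : ε ^ 2 ≤ ε * T := by
    rw [sq]; exact mul_le_mul_of_nonneg_left hcon.le hε.le
  -- This makes the statistical error in `hB` at most `T/32 * π`, half of the left-hand side there.
  -- It uses `ε² ≤ ε T ≤ 6λ s T` and `λ ≤ Λ⁴`.
  have hdev : 64 * (δ * k * Λ ^ 3) ≤ T := by
    have h1 : s * (64000 * (δ * k * Λ ^ 7)) ≤ s * (6 * lam * T) := by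
      have := mul_le_mul_of_nonneg_right (hcon.le.trans hTs) hT0.le
      linarith
    have h2 := le_of_mul_le_mul_left h1 (by linarith)
    have h3 : lam ≤ Λ ^ 4 := by
      have : Λ ^ 1 ≤ Λ ^ 4 := pow_le_pow_right₀ hΛ1 (by norm_num)
      rw [pow_one] at this
      linarith [sq_nonneg lam]
    have h4 : Λ ^ 4 * (64000 * (δ * k * Λ ^ 3)) ≤ Λ ^ 4 * (6 * T) := by
      have := mul_le_mul_of_nonneg_right h3 (by linarith : 0 ≤ 6 * T)
      linarith
    have h5 := le_of_mul_le_mul_left h4 (by positivity)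
    linarith
  have hπA : π ≤ 10 * Λ ^ 2 * αA := by
    have h1 : δ * Real.sqrt PSb ≤ T / 32 * π := by
      calc _ ≤ δ * (2 * Λ ^ 3 * k * π) := mul_le_mul_of_nonneg_left hsqrtb hδ
        _ = 64 * (δ * k * Λ ^ 3) / 32 * π := by ring
        _ ≤ _ := by gcongr
    have h2 : T / 32 * π ≤ T / 32 * (10 * Λ ^ 2 * αA) := by linarith
    exact le_of_mul_le_mul_left h2 (by linarith)
  have hsqrt : Real.sqrt PS ≤ 2 * Λ ^ 2 * s * Pβ := by
    apply Real.sqrt_le_iff.2 ⟨by positivity, ?_⟩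
    have h1 : PS ≤ 2 * Λ ^ 2 * Pβ := by
      have := le_mul_of_one_le_left hPβ.le hΛ2
      rw [hSum]; linarith
    have h2 : 0 ≤ 2 * Λ ^ 2 * Pβ := by positivity
    calc PS ≤ 2 * Λ ^ 2 * Pβ * 1 := by linarith
      _ ≤ 2 * Λ ^ 2 * Pβ * (k * Λ ^ 2 * Pβ) := mul_le_mul_of_nonneg_left hPβ1 h2
      _ ≤ 4 * (Λ ^ 2 * Pβ * (k * Λ ^ 2 * Pβ)) := by
          have : 0 ≤ Λ ^ 2 * Pβ * (k * Λ ^ 2 * Pβ) := by positivity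
          linarith
      _ = _ := by rw [← hs2]; ring
  have hT1 : T ≤ 320 * Λ ^ 8 * s * δ := by
    refine le_of_mul_le_mul_right ?_ hPβ
    calc T * Pβ ≤ T * (k * Λ ^ 2 * (10 * Λ ^ 2 * αA)) :=
          mul_le_mul_of_nonneg_left
            (hβb.trans (mul_le_mul_of_nonneg_left hπA (by positivity))) hT0.le
      _ = 10 * Λ ^ 4 * (k * T * αA) := by ring
      _ ≤ 10 * Λ ^ 4 * (16 * Λ ^ 2 * (δ * (2 * Λ ^ 2 * s * Pβ))) := by
          refine mul_le_mul_of_nonneg_left (hC.trans ?_) (by positivity)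
          refine mul_le_mul_of_nonneg_left (hglob.trans ?_) (by positivity)
          exact mul_le_mul_of_nonneg_left hsqrt hδ
      _ = _ := by ring
  have hTk : 200 * k ≤ Λ * ε := by
    have h1 : T * (200 * k) ≤ T * (Λ * ε) := by
      calc T * (200 * k) ≤ 320 * Λ ^ 8 * s * δ * (200 * k) :=
            mul_le_mul_of_nonneg_right hT1 (by positivity)
        _ = Λ * (64000 * (δ * (k * s * Λ ^ 7))) := by ring
        _ ≤ Λ * (ε * T) := mul_le_mul_of_nonneg_left (hδε.trans hεT) hΛ0.le
        _ = _ := by ring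
    exact le_of_mul_le_mul_left h1 hT0
  have h1 : ε ^ 2 ≤ 36 * lam ^ 2 * k := by
    rw [← hs2]
    have : ε ≤ 6 * lam * s := by linarith
    calc ε ^ 2 ≤ (6 * lam * s) ^ 2 := pow_le_pow_left₀ hε.le this 2
      _ = _ := by ring
  have h2 : ε * (200 * ε) ≤ ε * (36 * lam ^ 2 * Λ) := by
    have := mul_le_mul_of_nonneg_left hTk (by positivity : 0 ≤ 36 * lam ^ 2)
    linarith
  have h3 := le_of_mul_le_mul_left h2 hε
  have h4 : lam ^ 2 * Λ ≤ 2 * Λ * Λ := mul_le_mul_of_nonneg_right (by linarith) hΛ0.le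
  have h5 : 0 < Λ * Λ := mul_pos hΛ0 hΛ0
  rw [sq Λ] at large
  linarith

variable {n k : ℕ} [NeZero k] (M : PairwiseModel n k) {lam : ℝ}

theorem sum_mass_eq_le (hl : M.width ≤ lam) (i : Fin n) (α β : Fin k) :
    ∑ z with z i = α, M.mass z ≤ Real.exp (2 * lam) * ∑ z with z i = β, M.mass z := by
  simpa using sum_filter_mass_update_le M hl i β α (H := fun _ => 1) (fun _ => zero_le_one)

theorem sum_mass_and_le (hl : M.width ≤ lam) {i j : Fin n} (hij : j ≠ i) (α β b : Fin k) :
    ∑ z with z i = α, M.mass z * (if z j = b then 1 else 0)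
      ≤ Real.exp (2 * lam) * ∑ z with z i = β, M.mass z * (if z j = b then 1 else 0) := by
  simpa [Function.update_of_ne hij] using sum_filter_mass_update_le M hl i β α
    (H := fun z => if z j = b then 1 else 0) (fun _ => by split_ifs <;> norm_num)

theorem sum_mass_eq_le_and (hl : M.width ≤ lam) {i j : Fin n} (hij : j ≠ i) (β b : Fin k) :
    ∑ z with z i = β, M.mass z
      ≤ k * Real.exp (2 * lam)
        * ∑ z with z i = β, M.mass z * (if z j = b then 1 else 0) := by
  have := sum_mass_update_le M hl j b
    (H := fun z => if z i = β then 1 else 0) (fun _ => by split_ifs <;> norm_num)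
  simp only [Function.update_of_ne hij.symm, mul_ite, mul_one, mul_zero, ← Finset.sum_filter,
    Finset.filter_filter] at this ⊢
  simpa only [and_comm] using this

theorem sum_trueWeights_row {i j : Fin n} (hij : j ≠ i) (α β : Fin k) :
    ∑ a, trueWeights M i α β j a = 0 := by
  simp only [trueWeights_of_ne M hij, Finset.sum_sub_distrib, M.row_centered i j hij.symm,
    sub_zero]

/-- Upper bound for the error of a centered weight, in terms of risk bounds. -/
theorem centered_error_le (hl : M.width ≤ lam) {i j : Fin n} (hij : j ≠ i) {α β : Fin k}
    (h : α ≠ β) {w : Matrix (Fin n) (Fin k) ℝ} (hw : w ∈ feasible n k lam) (b : Fin k)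
    {δ ε : ℝ} (hδ : 0 ≤ δ) (hε : 0 < ε)
    (hδε : 64000 * (δ * (k * Real.sqrt k * Real.exp (7 * lam))) ≤ ε ^ 2)
    (hglob : ∑ z with (z i = α ∨ z i = β),
        M.mass z * (logLoss i α w z - logLoss i α (trueWeights M i α β) z)
      ≤ δ * Real.sqrt (∑ z with (z i = α ∨ z i = β), M.mass z))
    (hloc : ∀ c, |c| ≤ |w j b| → ∑ z with ((z i = α ∨ z i = β) ∧ z j = b),
        M.mass z * (logLoss i α w z - logLoss i α (setEntry w j b c) z)
      ≤ δ * Real.sqrt (∑ z with ((z i = α ∨ z i = β) ∧ z j = b), M.mass z)) :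
    center i w j b - trueWeights M i α β j b ≤ ε := by
  by_contra! hcon
  have hl0 : 0 ≤ lam := M.width_nonneg.trans hl
  set T := center i w j b - trueWeights M i α β j b with hTdef
  set m := (1 / (k : ℝ)) * ∑ a, w j a with hm_def
  have hTw : T = w j b - m - trueWeights M i α β j b := by rw [hTdef, center_of_ne hij]
  have hU : T = (w j b - trueWeights M i α β j b)
      - (1 / (k : ℝ)) * ∑ a, (w j a - trueWeights M i α β j a) := by
    rw [Finset.sum_sub_distrib, sum_trueWeights_row M hij, sub_zero, hTw]; ring
  have hA := sum_mass_mul_min_le M hl hij h w b hU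
  have hk : 1 ≤ (k : ℝ) := by exact_mod_cast NeZero.pos k
  set s := Real.sqrt k with hs_def
  have hs2 : s * s = k := Real.mul_self_sqrt (by linarith)
  have hs1 : 1 ≤ s := Real.one_le_sqrt.2 hk
  have hΛ1 : 1 ≤ Real.exp lam := Real.one_le_exp hl0
  have hΛq := Real.quadratic_le_exp_of_nonneg hl0
  have e2 : Real.exp (2 * lam) = Real.exp lam ^ 2 := by rw [← Real.exp_nat_mul]; norm_num
  have e4 : Real.exp (4 * lam) = Real.exp lam ^ 4 := by rw [← Real.exp_nat_mul]; norm_num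
  have e7 : Real.exp (7 * lam) = Real.exp lam ^ 7 := by rw [← Real.exp_nat_mul]; norm_num
  have hSum := sum_filter_or i h M.mass
  have hSb : ∑ z with ((z i = α ∨ z i = β) ∧ z j = b), M.mass z
      = ∑ z with z i = α, M.mass z * (if z j = b then 1 else 0)
        + ∑ z with z i = β, M.mass z * (if z j = b then 1 else 0) := by
    have := sum_filter_and_eq (S := fun z : Fin n → Fin k => z i = α ∨ z i = β)
      (Q := fun z => z j = b) M.mass fun _ => 1
    rw [sum_filter_or i h] at this
    simpa using this
  have hPα1 := one_le_mul_sum_mass M hl i α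
  have hPβ1 := one_le_mul_sum_mass M hl i β
  have hαβ := sum_mass_eq_le M hl i α β
  have hαβb := sum_mass_and_le M hl hij α β b
  have hβb := sum_mass_eq_le_and M hl hij β b
  have hB := fun hT hTl hwb => local_risk_ge M hl hij h w b (T := T) hT hTl hwb
  have hC := fun hT hwb => excess_ge_of_rest M hl hij h w b (T := T) hT hwb
  rw [e2] at hPα1 hPβ1 hαβ hαβb hβb
  simp only [e2] at hB hC
  rw [e4] at hA
  rw [e7] at hδε
  set Λ := Real.exp lam
  set PS := ∑ z with (z i = α ∨ z i = β), M.mass z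
  set PSb := ∑ z with ((z i = α ∨ z i = β) ∧ z j = b), M.mass z
  set Pα := ∑ z with z i = α, M.mass z
  set Pβ := ∑ z with z i = β, M.mass z
  set π := ∑ z with z i = β, M.mass z * (if z j = b then (1 : ℝ) else 0)
  set E := ∑ z with (z i = α ∨ z i = β),
        M.mass z * (logLoss i α w z - logLoss i α (trueWeights M i α β) z)
  have hΛ0 : 0 < Λ := by linarith
  have hPβ : 0 < Pβ := by
    by_contra! hneg
    have : (k : ℝ) * Λ ^ 2 * Pβ ≤ 0 := mul_nonpos_of_nonneg_of_nonpos (by positivity) hneg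
    linarith
  have hPα : 0 < Pα := by
    by_contra! hneg
    have : (k : ℝ) * Λ ^ 2 * Pα ≤ 0 := mul_nonpos_of_nonneg_of_nonpos (by positivity) hneg
    linarith
  have hPS : 0 < PS := by rw [hSum]; linarith
  have hT0 : 0 < T := hε.trans hcon
  have large : 500 * Λ ^ 2 < ε :=
    error_large_of_risk_le hk hs1 hs2 hΛ1 hT0 hε hcon hPS
      (by rw [hSum]; linarith [show 0 ≤ (k : ℝ) * Λ ^ 2 * Pα by positivity]) hδε hA hglob
  have hΛsq : 1 + 2 * lam ≤ Λ ^ 2 := by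
    have := pow_le_pow_left₀ (by linarith) (by linarith [sq_nonneg lam] : 1 + lam ≤ Λ) 2
    linarith [sq_nonneg lam]
  have hfeas : norm21 w ≤ 2 * lam * s := hw
  have hmean : |m| ≤ 2 * lam := by
    refine (abs_row_mean_le w j).trans ?_
    rw [div_le_iff₀ (by linarith)]
    exact hfeas
  have hws : |trueWeights M i α β j b| ≤ 2 * lam := by
    rw [trueWeights_of_ne M hij]
    refine (abs_sub _ _).trans ?_
    linarith [M.abs_W_le_width hij α b, M.abs_W_le_width hij β b]
  have hmean' := abs_le.1 hmean
  have hws' := abs_le.1 hws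
  have hwjb : w j b ≤ 2 * lam * s :=
    (le_abs_self _).trans ((abs_row_le_norm21 w j b).trans hfeas)
  have hTs : T ≤ 6 * lam * s := by
    have := le_mul_of_one_le_right hl0 hs1
    linarith
  -- The row mean and the true weight are at most `2λ` in absolute value, negligible against `T >
  -- 500 Λ²`.
  have hwT : 7 / 8 * T ≤ w j b := by linarith
  have hB := hB (by linarith) (by linarith) hwT
  have hC := hC (by linarith) hmean
  have hloc := hloc (w j b - T / 4) (by
    rw [abs_of_nonneg (by linarith), abs_of_nonneg (by linarith)]; linarith)
  set αA := ∑ z with z i = α,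
    M.mass z * (if z j = b ∧ predictorRest i j w z < -(T / 8) then (1 : ℝ) else 0)
  exact error_le_of_large hk hs1 hs2 hΛ1 hl0 hΛq hε hcon hPβ hSum hSb hPβ1 hαβ hαβb hβb hδ hδε
    hTs large (by linarith) hC hglob

theorem logLoss_swap {i : Fin n} {α β : Fin k} (h : α ≠ β) (w : Matrix (Fin n) (Fin k) ℝ)
    {z : Fin n → Fin k} (hz : z i = α ∨ z i = β) :
    logLoss i β (-w) z = logLoss i α w z := by
  unfold logLoss label
  rw [predictor_neg]
  rcases hz with hz | hz
  · simp [hz, h]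
  · simp [hz, h.symm]

/-- Two-sided version of `centered_error_le`. -/
theorem abs_centered_error_le (hl : M.width ≤ lam) {i j : Fin n} (hij : j ≠ i) {α β : Fin k}
    (h : α ≠ β) {w : Matrix (Fin n) (Fin k) ℝ} (hw : w ∈ feasible n k lam) (b : Fin k)
    {δ ε : ℝ} (hδ : 0 ≤ δ) (hε : 0 < ε)
    (hδε : 64000 * (δ * (k * Real.sqrt k * Real.exp (7 * lam))) ≤ ε ^ 2)
    (hglob : ∑ z with (z i = α ∨ z i = β),
        M.mass z * (logLoss i α w z - logLoss i α (trueWeights M i α β) z)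
      ≤ δ * Real.sqrt (∑ z with (z i = α ∨ z i = β), M.mass z))
    (hloc : ∀ c, |c| ≤ |w j b| → ∑ z with ((z i = α ∨ z i = β) ∧ z j = b),
        M.mass z * (logLoss i α w z - logLoss i α (setEntry w j b c) z)
      ≤ δ * Real.sqrt (∑ z with ((z i = α ∨ z i = β) ∧ z j = b), M.mass z)) :
    |center i w j b - (M.W i j α b - M.W i j β b)| ≤ ε := by
  rw [← trueWeights_of_ne M hij]
  refine abs_le.2 ⟨?_, centered_error_le M hl hij h hw b hδ hε hδε hglob hloc⟩
  -- The lower bound is the upper bound for `-w` with `α` and `β` exchanged, which leaves the losses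
  -- on the pair event unchanged.
  have hw' : -w ∈ feasible n k lam := by
    simpa [feasible, norm21_neg] using hw
  have := centered_error_le M hl hij h.symm hw' b hδ hε hδε ?_ ?_
  · rw [center_of_ne hij, trueWeights_swap] at this
    rw [center_of_ne hij]
    simp only [Matrix.neg_apply, Finset.sum_neg_distrib] at this
    linarith
  · simp only [or_comm (b := _ = α)]
    refine le_trans (le_of_eq ?_) hglob
    refine Finset.sum_congr rfl fun z hz => ?_
    have hz := (Finset.mem_filter.1 hz).2
    rw [trueWeights_swap, logLoss_swap h _ hz, logLoss_swap h _ hz]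
  · intro c hc
    simp only [or_comm (b := _ = α)]
    refine le_trans (le_of_eq ?_) (hloc (-c) (by simpa using hc))
    refine Finset.sum_congr rfl fun z hz => ?_
    have hz := (Finset.mem_filter.1 hz).2.1
    rw [setEntry_neg, logLoss_swap h _ hz, logLoss_swap h _ hz]

end PairwiseLearning

/-! ### Probability of a misleading empirical risk -/

namespace PairwiseLearning

variable {n k N : ℕ}

theorem norm21_eq_sum_norm (w : Matrix (Fin n) (Fin k) ℝ) :
    ∑ l, ‖(WithLp.toLp 2 (w l) : EuclideanSpace ℝ (Fin k))‖ = norm21 w := by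
  unfold norm21
  refine Finset.sum_congr rfl fun l _ => ?_
  rw [EuclideanSpace.norm_eq]
  simp

variable [NeZero k] (M : PairwiseModel n k) {lam : ℝ}

theorem sum_inner_single (i : Fin n) (w : Matrix (Fin n) (Fin k) ℝ) (z : Fin n → Fin k) :
    ∑ l, inner ℝ (WithLp.toLp 2 (w l) : EuclideanSpace ℝ (Fin k))
      (EuclideanSpace.single (Function.update z i 0 l) (1 : ℝ)) = predictor i w z := by
  rw [predictor_eq]
  refine Finset.sum_congr rfl fun l _ => ?_
  simp [EuclideanSpace.inner_single_right]

theorem abs_label_mul_sub (i : Fin n) (α : Fin k) (z : Fin n → Fin k) (u v : ℝ) :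
    |-(label i α z * u) - -(label i α z * v)| = |u - v| := by
  unfold label
  split_ifs
  · rw [show -(1 * u) - -(1 * v) = -(u - v) by ring, abs_neg]
  · congr 1; ring

/-- The samples for which, on the event `G`, some parameter has a smaller empirical risk than
another one, but a population risk larger by more than `c`. -/
def RiskViolation (i : Fin n) (α : Fin k) (G : (Fin n → Fin k) → Prop) [DecidablePred G]
    (lam c : ℝ) (z : Fin N → Fin n → Fin k) : Prop :=
  ∃ w ∈ feasible n k lam, ∃ w' ∈ feasible n k lam,
    (∑ t, if G (z t) then logLoss i α w (z t) else 0)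
      ≤ (∑ t, if G (z t) then logLoss i α w' (z t) else 0) ∧
    c < ∑ x with G x, M.mass x * (logLoss i α w x - logLoss i α w' x)

/-- A violation by `w`, `w'` makes the difference of their deviations exceed `2θ`, so `w` deviates
above `θ` or `w'` below `-θ`. Both signs are covered by `uniform_deviation`. -/
theorem sum_riskViolation_le (i : Fin n) (α : Fin k) (G : (Fin n → Fin k) → Prop)
    [DecidablePred G] (hlam : 0 < lam) {T : ℝ} (hT : 0 < T)
    (hTq : T ≤ N * ∑ x with G x, M.mass x) (B : Finset (Fin N → Fin n → Fin k))
    (hB : ∀ z ∈ B, RiskViolation M i α G lam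
      (16 * lam * Real.sqrt k * Real.sqrt (T / N) * Real.sqrt (∑ x with G x, M.mass x)) z) :
    ∑ z ∈ B, ∏ t, M.mass (z t) ≤ 4 * n * Real.exp (-T) := by
  classical
  have hk : 0 < (k : ℝ) := Nat.cast_pos.2 (NeZero.pos k)
  have hq0 : 0 ≤ ∑ x with G x, M.mass x :=
    Finset.sum_nonneg fun z _ => (M.mass_pos z).le
  have hN : 0 < (N : ℝ) := by
    rcases (Nat.cast_nonneg N : (0 : ℝ) ≤ N).eq_or_lt with h | h
    · rw [← h, zero_mul] at hTq; linarith
    · exact h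
  have : Nonempty (Fin n) := ⟨i⟩
  set q := ∑ x with G x, M.mass x with hq
  set r := 2 * lam * Real.sqrt k with hr_def
  have hr : 0 < r := by have := Real.sqrt_pos.2 hk; positivity
  have hp : ∀ z : Fin N → Fin n → Fin k, 0 ≤ ∏ t, M.mass (z t) :=
    fun z => Finset.prod_nonneg fun t _ => (M.mass_pos _).le
  set g : (Fin n → Fin k) → Fin n → EuclideanSpace ℝ (Fin k) :=
    fun z l => EuclideanSpace.single (Function.update z i 0 l) (1 : ℝ)
  have hg : ∀ x l, ‖g x l‖ ≤ 1 := fun x l => by simp [g]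
  -- The constant makes `ψ` vanish at `0`, as contraction requires, and cancels in differences of
  -- losses.
  set ψ : (Fin n → Fin k) → ℝ → ℝ := fun z u => softplus (-(label i α z * u)) - Real.log 2
  have hψ0 : ∀ x, ψ x 0 = 0 := fun x => by simp [ψ, softplus_zero]
  have hψ : ∀ x u v, |ψ x u - ψ x v| ≤ |u - v| := fun x u v => by
    simp only [ψ, sub_sub_sub_cancel_right]
    exact (abs_softplus_sub_le _ _).trans (abs_label_mul_sub i α x u v).le
  set D : Matrix (Fin n) (Fin k) ℝ → (Fin N → Fin n → Fin k) → ℝ := fun w z =>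
    ∑ t, ((∑ x, M.mass x * if G x then ψ x (predictor i w x) else 0)
      - if G (z t) then ψ (z t) (predictor i w (z t)) else 0) with hD
  set θ := 4 * r * Real.sqrt (T * (N * q)) with hθ
  set B₁ := B.filter fun z => ∃ w, norm21 w ≤ r ∧ θ < D w z
  set B₂ := B.filter fun z => ∃ w, norm21 w ≤ r ∧ θ < -D w z
  have hqi : q = ∑ x, if G x then M.mass x else 0 := by rw [hq, Finset.sum_filter]
  have h1 : ∑ z ∈ B₁, ∏ t, M.mass (z t) ≤ 2 * n * Real.exp (-T) := by
    have := uniform_deviation (N := N) (fun x => (M.mass_pos x).le) M.sum_mass G g hg ψ hψ0 hψ hr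
      hqi hT hTq B₁ (fun z hz => by
        obtain ⟨w, hw, hd⟩ := (Finset.mem_filter.1 hz).2
        refine ⟨fun l => WithLp.toLp 2 (w l), by rwa [norm21_eq_sum_norm], ?_⟩
        simpa only [g, sum_inner_single] using hd)
    simpa using this
  have h2 : ∑ z ∈ B₂, ∏ t, M.mass (z t) ≤ 2 * n * Real.exp (-T) := by
    have := uniform_deviation (N := N) (fun x => (M.mass_pos x).le) M.sum_mass G g hg
      (fun x u => -ψ x u) (fun x => by simp [hψ0])
      (fun x u v => by rw [neg_sub_neg, abs_sub_comm]; exact hψ x u v) hr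
      hqi hT hTq B₂ (fun z hz => by
        obtain ⟨w, hw, hd⟩ := (Finset.mem_filter.1 hz).2
        refine ⟨fun l => WithLp.toLp 2 (w l), by rwa [norm21_eq_sum_norm], ?_⟩
        simp only [g, sum_inner_single]
        refine hd.trans_le (le_of_eq ?_)
        simp only [hD]
        rw [← Finset.sum_neg_distrib]
        refine Finset.sum_congr rfl fun t _ => ?_
        rw [neg_sub', ← Finset.sum_neg_distrib]
        congr 1
        · refine Finset.sum_congr rfl fun x _ => ?_
          split_ifs <;> simp
        · split_ifs <;> simp)
    simpa using this
  have hcover : B ⊆ B₁ ∪ B₂ := by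
    intro z hz
    obtain ⟨w, hw, w', hw', hemp, hpop⟩ := hB z hz
    by_contra hcon
    simp only [B₁, B₂, Finset.mem_union, Finset.mem_filter, hz, true_and, not_or, not_exists,
      not_and, not_lt] at hcon
    have c1 := hcon.1 w hw
    have c2 := hcon.2 w' hw'
    have hdiff : D w z - D w' z
        = N * (∑ x with G x, M.mass x * (logLoss i α w x - logLoss i α w' x))
          - ((∑ t, if G (z t) then logLoss i α w (z t) else 0)
            - ∑ t, if G (z t) then logLoss i α w' (z t) else 0) := by
      simp only [hD]
      rw [Finset.sum_sub_distrib, Finset.sum_sub_distrib, Finset.sum_const, Finset.sum_const,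
        Finset.card_univ, Fintype.card_fin, nsmul_eq_mul, nsmul_eq_mul, Finset.sum_filter]
      have e1 : (∑ x, if G x then M.mass x * (logLoss i α w x - logLoss i α w' x) else 0)
          = (∑ x, M.mass x * if G x then ψ x (predictor i w x) else 0)
            - ∑ x, M.mass x * if G x then ψ x (predictor i w' x) else 0 := by
        rw [← Finset.sum_sub_distrib]
        refine Finset.sum_congr rfl fun x _ => ?_
        split_ifs
        · simp only [ψ, logLoss]; ring
        · simp
      have e2 : (∑ t, if G (z t) then logLoss i α w (z t) else 0)
            - (∑ t, if G (z t) then logLoss i α w' (z t) else 0)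
          = (∑ t, if G (z t) then ψ (z t) (predictor i w (z t)) else 0)
            - ∑ t, if G (z t) then ψ (z t) (predictor i w' (z t)) else 0 := by
        rw [← Finset.sum_sub_distrib, ← Finset.sum_sub_distrib]
        refine Finset.sum_congr rfl fun x _ => ?_
        split_ifs
        · simp only [ψ, logLoss]; ring
        · simp
      rw [e1, e2]
      ring
    have hNθ : N * (16 * lam * Real.sqrt k * Real.sqrt (T / N) * Real.sqrt q) = 2 * θ := by
      rw [hθ, hr_def, Real.sqrt_mul hT.le, Real.sqrt_mul hN.le, Real.sqrt_div hT.le]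
      have : (N : ℝ) = Real.sqrt N * Real.sqrt N := (Real.mul_self_sqrt hN.le).symm
      have h0 := Real.sqrt_pos.2 hN
      calc _ = 16 * lam * Real.sqrt k * Real.sqrt T * Real.sqrt q * (N / Real.sqrt N) := by ring
        _ = 16 * lam * Real.sqrt k * Real.sqrt T * Real.sqrt q * Real.sqrt N := by
            rw [Real.div_sqrt]
        _ = _ := by ring
    have := mul_lt_mul_of_pos_left hpop hN
    rw [hNθ] at this
    linarith
  calc ∑ z ∈ B, ∏ t, M.mass (z t) ≤ ∑ z ∈ B₁ ∪ B₂, ∏ t, M.mass (z t) :=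
        Finset.sum_le_sum_of_subset_of_nonneg hcover fun z _ _ => hp z
    _ ≤ ∑ z ∈ B₁, ∏ t, M.mass (z t) + ∑ z ∈ B₂, ∏ t, M.mass (z t) := by
        rw [← Finset.sum_union_inter]
        exact le_add_of_nonneg_right (Finset.sum_nonneg fun z _ => hp z)
    _ ≤ _ := by linarith

/-- The probability of a set of samples from the model. -/
theorem measureReal_sample_le {Ω : Type*} [MeasurableSpace Ω] (P : Measure Ω)
    [IsProbabilityMeasure P] (Z : Fin N → Ω → (Fin n → Fin k)) (hZ : ∀ m, Measurable (Z m))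
    (hI : iIndepFun Z P) (hL : ∀ m, HasLaw (Z m) M.dist P)
    (B : Finset (Fin N → Fin n → Fin k)) :
    P.real {ω | (fun m => Z m ω) ∈ B} ≤ ∑ z ∈ B, ∏ t, M.mass (z t) := by
  have hset : {ω | (fun m => Z m ω) ∈ B} = ⋃ z ∈ B, ⋂ m, Z m ⁻¹' {z m} := by
    ext ω
    simp only [Set.mem_ofPred_eq, Set.mem_iUnion, Set.mem_iInter, Set.mem_preimage,
      Set.mem_singleton_iff, exists_prop]
    constructor
    · intro h
      exact ⟨_, h, fun m => rfl⟩
    · rintro ⟨z, hz, h⟩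
      rwa [show (fun m => Z m ω) = z from funext h]
  rw [hset]
  refine (measureReal_biUnion_finset_le _ _).trans (Finset.sum_le_sum fun z _ => le_of_eq ?_)
  have h := hI.meas_iInter (s := fun m => Z m ⁻¹' {z m})
    (fun m => ⟨{z m}, measurableSet_singleton _, rfl⟩)
  rw [Measure.real, h, ENNReal.toReal_prod]
  refine Finset.prod_congr rfl fun m _ => ?_
  rw [← Measure.map_apply (hZ m) (measurableSet_singleton _), (hL m).map_eq, M.dist_singleton,
    ENNReal.toReal_ofReal (M.mass_pos _).le]

theorem measureReal_riskViolation_le {Ω : Type*} [MeasurableSpace Ω] (P : Measure Ω)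
    [IsProbabilityMeasure P] (Z : Fin N → Ω → (Fin n → Fin k)) (hZ : ∀ m, Measurable (Z m))
    (hI : iIndepFun Z P) (hL : ∀ m, HasLaw (Z m) M.dist P)
    (i : Fin n) (α : Fin k) (G : (Fin n → Fin k) → Prop)
    [DecidablePred G] (hlam : 0 < lam) {T : ℝ} (hT : 0 < T)
    (hTq : T ≤ N * ∑ x with G x, M.mass x) :
    P.real {ω | RiskViolation M i α G lam
      (16 * lam * Real.sqrt k * Real.sqrt (T / N) * Real.sqrt (∑ x with G x, M.mass x))
      (fun m => Z m ω)} ≤ 4 * n * Real.exp (-T) := by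
  classical
  have h := measureReal_sample_le M P Z hZ hI hL (Finset.univ.filter fun z => RiskViolation M i α G
    lam (16 * lam * Real.sqrt k * Real.sqrt (T / N) * Real.sqrt (∑ x with G x, M.mass x)) z)
  simp only [Finset.mem_filter, Finset.mem_univ, true_and] at h
  exact h.trans (sum_riskViolation_le M i α G hlam hT hTq _ fun z hz => (Finset.mem_filter.1 hz).2)

end PairwiseLearning

/-! ### Existence and optimality of the minimizers, averaging of the estimates -/

namespace PairwiseLearning

variable {n k N : ℕ}

theorem continuous_norm21 : Continuous (norm21 (n := n) (k := k)) := by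
  unfold norm21
  fun_prop

theorem isCompact_feasible (lam : ℝ) : IsCompact (feasible n k lam) := by
  set r := 2 * lam * Real.sqrt k
  have hbox : IsCompact (Set.univ.pi fun _ : Fin n => Set.univ.pi fun _ : Fin k =>
      Set.Icc (-r) r) := isCompact_univ_pi fun _ => isCompact_univ_pi fun _ => isCompact_Icc
  refine hbox.of_isClosed_subset (isClosed_le continuous_norm21 continuous_const) ?_
  intro w hw j _ b _
  refine abs_le.1 (le_trans ?_ hw)
  refine le_trans ?_ (Finset.single_le_sum (f := fun j => Real.sqrt (∑ b, w j b ^ 2))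
    (fun _ _ => Real.sqrt_nonneg _) (Finset.mem_univ j))
  apply Real.abs_le_sqrt
  exact Finset.single_le_sum (f := fun b => w j b ^ 2) (fun _ _ => sq_nonneg _)
    (Finset.mem_univ b)

variable [NeZero k] (M : PairwiseModel n k) {lam : ℝ}

theorem continuous_empLoss (z : Fin N → Fin n → Fin k) (i : Fin n) (α β : Fin k) :
    Continuous (empLoss z i α β) := by
  unfold empLoss matInner
  refine continuous_const.mul (continuous_finsetSum _ fun t _ => ?_)
  refine Continuous.log (by fun_prop) fun w => ?_
  positivity

theorem exists_isOutput (hlam : 0 ≤ lam) (z : Fin N → Fin n → Fin k) :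
    ∃ What, IsOutput lam z What := by
  have hne : (feasible n k lam).Nonempty := ⟨0, by simp [feasible, norm21]; positivity⟩
  have h : ∀ i α β, ∃ w, IsRegressionMinimizer lam z i α β w := fun i α β => by
    obtain ⟨w, hw, hm⟩ := (isCompact_feasible lam).exists_isMinOn hne
      (continuous_empLoss z i α β).continuousOn
    exact ⟨w, hw, hm⟩
  choose w hw using h
  exact ⟨fun i j => Matrix.of fun α b =>
    (1 / (k : ℝ)) * ∑ β, (if α = β then 0 else center i (w i α β) j b), w,
    fun i α β _ => hw i α β, fun i j _ α b => rfl⟩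

theorem IsRegressionMinimizer.sum_le {z : Fin N → Fin n → Fin k} {i : Fin n} {α β : Fin k}
    {w w' : Matrix (Fin n) (Fin k) ℝ} (h : IsRegressionMinimizer lam z i α β w)
    (hw' : w' ∈ feasible n k lam) :
    (∑ t, if z t i = α ∨ z t i = β then logLoss i α w (z t) else 0)
      ≤ ∑ t, if z t i = α ∨ z t i = β then logLoss i α w' (z t) else 0 := by
  have h1 := h.2 hw'
  simp only [Set.mem_ofPred_eq, empLoss] at h1
  have e : ∀ v : Matrix (Fin n) (Fin k) ℝ,
      (∑ t, if z t i = α ∨ z t i = β then logLoss i α v (z t) else 0)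
        = ∑ t ∈ selected z i α β,
          Real.log (1 + Real.exp (-(label i α (z t) * matInner v (covariate i (z t))))) := by
    intro v
    rw [selected, Finset.sum_filter]
    rfl
  rw [e, e]
  rcases (selected z i α β).eq_empty_or_nonempty with h0 | h0
  · simp [h0]
  · have : 0 < ((selected z i α β).card : ℝ) := Nat.cast_pos.2 h0.card_pos
    exact le_of_mul_le_mul_left h1 (by positivity)

theorem predictor_setEntry_of_ne {i j : Fin n} (hij : j ≠ i) (w : Matrix (Fin n) (Fin k) ℝ)
    {b : Fin k} (c : ℝ) {z : Fin n → Fin k} (hz : z j ≠ b) :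
    predictor i (setEntry w j b c) z = predictor i w z := by
  rw [predictor_eq, predictor_eq]
  refine Finset.sum_congr rfl fun l _ => ?_
  simp only [setEntry, Matrix.of_apply]
  rw [if_neg]
  rintro ⟨rfl, h⟩
  rw [Function.update_of_ne hij] at h
  exact hz h

/-- Entry `(j, b)` is seen only by samples with `z j = b`; all other terms cancel in the comparison.
The deviation can thus be measured on this smaller event. -/
theorem IsRegressionMinimizer.sum_setEntry_le {z : Fin N → Fin n → Fin k} {i j : Fin n}
    (hij : j ≠ i) {α β b : Fin k} {w : Matrix (Fin n) (Fin k) ℝ}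
    (h : IsRegressionMinimizer lam z i α β w) {c : ℝ}
    (hw' : setEntry w j b c ∈ feasible n k lam) :
    (∑ t, if (z t i = α ∨ z t i = β) ∧ z t j = b then logLoss i α w (z t) else 0)
      ≤ ∑ t, if (z t i = α ∨ z t i = β) ∧ z t j = b
        then logLoss i α (setEntry w j b c) (z t) else 0 := by
  have h1 := h.sum_le hw'
  rw [← sub_nonneg, ← Finset.sum_sub_distrib] at h1 ⊢
  refine h1.trans (le_of_eq (Finset.sum_congr rfl fun t _ => ?_))
  by_cases hS : z t i = α ∨ z t i = β
  · by_cases hb : z t j = b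
    · simp [hS, hb]
    · simp [hS, hb, logLoss, predictor_setEntry_of_ne hij w c hb]
  · simp [hS]

/-- The estimate averages over the second symbol, which preserves the accuracy. -/
theorem IsOutput.abs_sub_le {z : Fin N → Fin n → Fin k}
    {What : Fin n → Fin n → Matrix (Fin k) (Fin k) ℝ} (h : IsOutput lam z What) {ε : ℝ}
    (hε : 0 < ε) {i j : Fin n} (hij : j ≠ i)
    (hc : ∀ α β b w, α ≠ β → IsRegressionMinimizer lam z i α β w →
      |center i w j b - (M.W i j α b - M.W i j β b)| ≤ ε) (α b : Fin k) :
    |M.W i j α b - What i j α b| ≤ ε := by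
  obtain ⟨w, hw, hWhat⟩ := h
  have hk : 0 < (k : ℝ) := Nat.cast_pos.2 (NeZero.pos k)
  -- Since the columns of the weights are centered, averaging `W α b - W β b` over `β` returns `W α
  -- b`.
  have e : M.W i j α b
      = (1 / (k : ℝ)) * ∑ β, (if α = β then 0 else M.W i j α b - M.W i j β b) := by
    have : ∀ β, (if α = β then 0 else M.W i j α b - M.W i j β b)
        = M.W i j α b - M.W i j β b := fun β => by
      split_ifs with h
      · rw [h, sub_self]
      · rfl
    simp only [this, Finset.sum_sub_distrib, M.col_centered i j hij.symm]
    simp [hk.ne']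
  rw [hWhat i j hij α b, e, ← mul_sub, ← Finset.sum_sub_distrib, abs_mul,
    abs_of_pos (by positivity), one_div, inv_mul_le_iff₀ hk]
  calc _ ≤ ∑ β, |(if α = β then 0 else M.W i j α b - M.W i j β b)
          - if α = β then 0 else center i (w i α β) j b| := Finset.abs_sum_le_sum_abs _ _
    _ ≤ ∑ β : Fin k, ε := Finset.sum_le_sum fun β _ => by
        split_ifs with h
        · simpa using hε.le
        · rw [abs_sub_comm]
          exact hc α β b _ h (hw i α β h)
    _ = _ := by simp

/-- A bound on the error which only uses the constraint on the regression parameters. -/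
theorem abs_center_sub_le_of_feasible (hl : M.width ≤ lam) {i j : Fin n} (hij : j ≠ i)
    (α β b : Fin k) {w : Matrix (Fin n) (Fin k) ℝ} (hw : w ∈ feasible n k lam) :
    |center i w j b - (M.W i j α b - M.W i j β b)| ≤ 6 * lam * Real.sqrt k := by
  have hk : 1 ≤ (k : ℝ) := by exact_mod_cast NeZero.pos k
  have hs1 : 1 ≤ Real.sqrt k := Real.one_le_sqrt.2 hk
  have hl0 : 0 ≤ lam := M.width_nonneg.trans hl
  have hfeas : norm21 w ≤ 2 * lam * Real.sqrt k := hw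
  have h1 := (abs_row_le_norm21 w j b).trans hfeas
  have h2 : |(1 / (k : ℝ)) * ∑ a, w j a| ≤ 2 * lam := by
    refine (abs_row_mean_le w j).trans ?_
    rw [div_le_iff₀ (by linarith)]
    exact hfeas
  have h3 := (M.abs_W_le_width hij α b).trans hl
  have h4 := (M.abs_W_le_width hij β b).trans hl
  have h5 := le_mul_of_one_le_right hl0 hs1
  rw [center_of_ne hij]
  have := abs_le.1 h1
  have := abs_le.1 h2
  have := abs_le.1 h3
  have := abs_le.1 h4
  rw [abs_le]
  constructor <;> linarith

theorem one_le_mul_sum_pair_and (hl : M.width ≤ lam) {i j : Fin n} (hij : j ≠ i) {α β : Fin k}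
    (h : α ≠ β) (b : Fin k) :
    1 ≤ (k : ℝ) ^ 2 * Real.exp (4 * lam)
      * ∑ z with ((z i = α ∨ z i = β) ∧ z j = b), M.mass z := by
  have h1 := one_le_mul_sum_mass M hl i β
  have h2 := sum_mass_eq_le_and M hl hij β b
  have h3 : ∑ z with z i = β, M.mass z * (if z j = b then 1 else 0)
      ≤ ∑ z with ((z i = α ∨ z i = β) ∧ z j = b), M.mass z := by
    have := sum_filter_and_eq (S := fun z : Fin n → Fin k => z i = α ∨ z i = β)
      (Q := fun z => z j = b) M.mass fun _ => 1
    simp only [mul_one] at this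
    rw [this, sum_filter_or i h]
    refine le_add_of_nonneg_left (Finset.sum_nonneg fun z _ => mul_nonneg (M.mass_pos z).le ?_)
    split_ifs <;> norm_num
  have e4 : Real.exp (4 * lam) = Real.exp (2 * lam) * Real.exp (2 * lam) := by
    rw [← Real.exp_add]; ring_nf
  calc 1 ≤ k * Real.exp (2 * lam) * ∑ z with z i = β, M.mass z := h1
    _ ≤ k * Real.exp (2 * lam) * (k * Real.exp (2 * lam)
        * ∑ z with ((z i = α ∨ z i = β) ∧ z j = b), M.mass z) := by
        refine mul_le_mul_of_nonneg_left (h2.trans ?_) (by positivity)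
        exact mul_le_mul_of_nonneg_left h3 (by positivity)
    _ = _ := by rw [e4]; ring

theorem sum_pair_and_le (i j : Fin n) (α β b : Fin k) :
    ∑ z with ((z i = α ∨ z i = β) ∧ z j = b), M.mass z
      ≤ ∑ z with (z i = α ∨ z i = β), M.mass z := by
  refine Finset.sum_le_sum_of_subset_of_nonneg (fun z hz => ?_) fun z _ _ => (M.mass_pos z).le
  simp only [Finset.mem_filter, Finset.mem_univ, true_and] at hz ⊢
  exact hz.1

end PairwiseLearning

/-! ### Arithmetic of the sample size -/

section SampleSize

/-- The deviation allowed by the sample size is small enough. -/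
theorem deviation_le_of_sample_size {lam k L ε N : ℝ} (hk : 0 < k) (hL : 0 ≤ L)
    (hε : 0 < ε) (hN0 : 0 < N)
    (hN : 1536 * 64000 ^ 2 * (lam ^ 2 * k ^ 4 * Real.exp (14 * lam) * L / ε ^ 4) ≤ N) :
    64000 * (16 * lam * Real.sqrt k * Real.sqrt (6 * L / N)
      * (k * Real.sqrt k * Real.exp (7 * lam))) ≤ ε ^ 2 := by
  have e14 : Real.exp (14 * lam) = Real.exp (7 * lam) ^ 2 := by
    rw [← Real.exp_nat_mul]; push_cast; ring_nf
  rw [e14, mul_div_assoc', div_le_iff₀ (by positivity)] at hN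
  have hs : Real.sqrt k * Real.sqrt k = k := Real.mul_self_sqrt hk.le
  have hr : Real.sqrt (6 * L / N) ^ 2 = 6 * L / N := Real.sq_sqrt (by positivity)
  have hpos := Real.exp_pos (7 * lam)
  refine le_of_sq_le_sq ?_ (by positivity)
  calc _ = 64000 ^ 2 * 256 * lam ^ 2 * ((Real.sqrt k * Real.sqrt k) ^ 2)
        * Real.sqrt (6 * L / N) ^ 2 * k ^ 2 * Real.exp (7 * lam) ^ 2 := by ring
    _ = 1536 * 64000 ^ 2 * (lam ^ 2 * k ^ 4 * Real.exp (7 * lam) ^ 2 * L) / N := by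
        rw [hs, hr]; ring
    _ ≤ (ε ^ 2) ^ 2 := by
        rw [div_le_iff₀ hN0]
        linarith

/-- Supplies the condition `T ≤ N q` of the deviation bound with `T = 6 L`. As `ε⁴ ≤ 1296 λ⁴ k²`,
the sample size is at least a multiple of `k² e^{14λ} L / λ²`, and `λ² ≤ 2 e^{10λ}` leaves the
required `k² e^{4λ} L`. -/
theorem le_mul_of_sample_size {lam k L ε N q : ℝ} (hlam : 0 < lam) (hk : 1 ≤ k) (hL : 0 ≤ L)
    (hε : 0 < ε) (hεl : ε ≤ 6 * lam * Real.sqrt k) (hN0 : 0 ≤ N) (hq0 : 0 ≤ q)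
    (hq : 1 ≤ k ^ 2 * Real.exp (4 * lam) * q)
    (hN : 1536 * 64000 ^ 2 * (lam ^ 2 * k ^ 4 * Real.exp (14 * lam) * L / ε ^ 4) ≤ N) :
    6 * L ≤ N * q := by
  have e14 : Real.exp (14 * lam) = Real.exp (4 * lam) * Real.exp lam ^ 10 := by
    rw [← Real.exp_nat_mul, ← Real.exp_add]; push_cast; ring_nf
  have h1 : ε ^ 4 ≤ 1296 * lam ^ 4 * k ^ 2 := by
    calc ε ^ 4 ≤ (6 * lam * Real.sqrt k) ^ 4 := pow_le_pow_left₀ hε.le hεl 4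
      _ = 1296 * lam ^ 4 * ((Real.sqrt k) ^ 2) ^ 2 := by ring
      _ = _ := by rw [Real.sq_sqrt (by linarith)]
  have h2 : lam ^ 2 ≤ 2 * Real.exp lam ^ 10 := by
    have h3 := Real.quadratic_le_exp_of_nonneg hlam.le
    have h4 : Real.exp lam ^ 1 ≤ Real.exp lam ^ 10 :=
      pow_le_pow_right₀ (Real.one_le_exp hlam.le) (by norm_num)
    rw [pow_one] at h4
    linarith
  rw [mul_div_assoc', div_le_iff₀ (by positivity), e14] at hN
  set Y := Real.exp (4 * lam)
  set X := Real.exp lam ^ 10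
  have hY : 0 < Y := Real.exp_pos _
  have hX : 0 < X := by positivity
  have h5 : lam ^ 2 * k ^ 2 * X * (15552 * (k ^ 2 * Y * L)) ≤ lam ^ 2 * k ^ 2 * X * (2592 * N) := by
    calc _ ≤ 1536 * 64000 ^ 2 * (lam ^ 2 * k ^ 4 * (Y * X) * L) := by
          have : 0 ≤ lam ^ 2 * k ^ 4 * (Y * X) * L := by positivity
          nlinarith
      _ ≤ N * (1296 * lam ^ 4 * k ^ 2) := hN.trans (mul_le_mul_of_nonneg_left h1 hN0)
      _ = N * 1296 * lam ^ 2 * k ^ 2 * lam ^ 2 := by ring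
      _ ≤ N * 1296 * lam ^ 2 * k ^ 2 * (2 * X) := mul_le_mul_of_nonneg_left h2 (by positivity)
      _ = _ := by ring
  have h6 := le_of_mul_le_mul_left h5 (by positivity)
  calc 6 * L = 6 * L * 1 := by ring
    _ ≤ 6 * L * (k ^ 2 * Y * q) := mul_le_mul_of_nonneg_left hq (by positivity)
    _ = 6 * (k ^ 2 * Y * L) * q := by ring
    _ ≤ N * q := mul_le_mul_of_nonneg_right (by linarith) hq0

/-- There are `n k²` global events and `n k² * n k` local ones. The exponent `6` absorbs this
polynomial in `n k`, because `n k ≥ 2`. -/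
theorem union_bound_le {n k ρ : ℝ} (hn : 2 ≤ n) (hk : 1 ≤ k) (hρ : 0 < ρ) (hρ1 : ρ < 1) :
    n * k * k * (1 + n * k) * (4 * n * Real.exp (-(6 * Real.log (n * k / ρ)))) ≤ ρ := by
  have hx : 2 ≤ n * k := by nlinarith
  have e : Real.exp (-(6 * Real.log (n * k / ρ))) = (ρ / (n * k)) ^ 6 := by
    rw [← mul_neg, ← Real.log_inv, inv_div,
      show (6 : ℝ) * Real.log (ρ / (n * k)) = ((6 : ℕ) : ℝ) * Real.log (ρ / (n * k)) by norm_num,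
      Real.exp_nat_mul, Real.exp_log (by positivity)]
  rw [e]
  have hk0 : 0 < k := by linarith
  calc n * k * k * (1 + n * k) * (4 * n * (ρ / (n * k)) ^ 6)
      = 4 * (n * k) ^ 2 * (1 + n * k) * (ρ ^ 6 / (n * k) ^ 6) := by rw [div_pow]; ring
    _ ≤ ρ ^ 6 := by
        set x := n * k
        rw [mul_div_assoc', div_le_iff₀ (by positivity)]
        have h3 : 8 ≤ x ^ 3 := by
          calc (8 : ℝ) = 2 ^ 3 := by norm_num
            _ ≤ x ^ 3 := pow_le_pow_left₀ (by norm_num) hx 3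
        have h4 : 4 * x ^ 2 * (1 + x) ≤ x ^ 6 := by
          calc 4 * x ^ 2 * (1 + x) ≤ 4 * x ^ 2 * (2 * x) := by
                refine mul_le_mul_of_nonneg_left (by linarith) (by positivity)
            _ = 8 * x ^ 3 := by ring
            _ ≤ x ^ 3 * x ^ 3 := mul_le_mul_of_nonneg_right h3 (by positivity)
            _ = _ := by ring
        rw [mul_comm]
        exact mul_le_mul_of_nonneg_left h4 (by positivity)
    _ ≤ ρ := pow_le_of_le_one hρ.le hρ1.le (by norm_num)

end SampleSize

/-! ### The main theorem -/

namespace PairwiseLearning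

variable {n k N : ℕ} [NeZero k] (M : PairwiseModel n k) {lam : ℝ}

/-- Outside the risk violations, every regression minimizer recovers the centered weights. -/
theorem abs_center_sub_le_of_not_riskViolation (hl : M.width ≤ lam) {i j : Fin n} (hij : j ≠ i)
    {α β b : Fin k} (h : α ≠ β) {δ ε : ℝ} (hδ : 0 ≤ δ) (hε : 0 < ε)
    (hδε : 64000 * (δ * (k * Real.sqrt k * Real.exp (7 * lam))) ≤ ε ^ 2)
    {z : Fin N → Fin n → Fin k}
    (h1 : ¬ RiskViolation M i α (fun x => x i = α ∨ x i = β) lam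
      (δ * Real.sqrt (∑ x with (x i = α ∨ x i = β), M.mass x)) z)
    (h2 : ¬ RiskViolation M i α (fun x => (x i = α ∨ x i = β) ∧ x j = b) lam
      (δ * Real.sqrt (∑ x with ((x i = α ∨ x i = β) ∧ x j = b), M.mass x)) z)
    {w : Matrix (Fin n) (Fin k) ℝ} (hw : IsRegressionMinimizer lam z i α β w) :
    |center i w j b - (M.W i j α b - M.W i j β b)| ≤ ε := by
  refine abs_centered_error_le M hl hij h hw.1 b hδ hε hδε ?_ fun c hc => ?_
  · by_contra! hcon
    have hlam : 0 ≤ lam := M.width_nonneg.trans hl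
    have hf : trueWeights M i α β ∈ feasible n k lam := norm21_trueWeights_le M hl i α β
    exact h1 ⟨w, hw.1, _, hf, hw.sum_le hf, hcon⟩
  · by_contra! hcon
    have hf : setEntry w j b c ∈ feasible n k lam := (norm21_setEntry_le w j b hc).trans hw.1
    exact h2 ⟨w, hw.1, _, hf, hw.sum_setEntry_le hij hf, hcon⟩

end PairwiseLearning

open PairwiseLearning in
/-- There is a universal constant `C` such that, for samples `Z 0, …, Z (N-1)` drawn independently
from a pairwise graphical model of width at most `lam`, `N ≥ C λ² k⁴ e^{14λ} ln(nk/ρ) / ε⁴` implies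
that with probability at least `1 - ρ` the algorithm has an output and each of its possible
outputs is entrywise `ε`-close to the true weights. -/
theorem mainTheorem3 :
    ∃ C : ℝ, 0 < C ∧
      ∀ (n k : ℕ) [NeZero k] (M : PairwiseModel n k) (lam : ℝ), M.width ≤ lam →
      ∀ (ρ ε : ℝ), 0 < ρ → ρ < 1 → 0 < ε →
      ∀ (N : ℕ),
        C * (lam ^ 2 * (k : ℝ) ^ 4 * Real.exp (14 * lam) * Real.log ((n : ℝ) * (k : ℝ) / ρ)
          / ε ^ 4) ≤ (N : ℝ) →
      ∀ {Ω : Type*} [MeasurableSpace Ω] (P : Measure Ω) [IsProbabilityMeasure P]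
        (Z : Fin N → Ω → (Fin n → Fin k)),
        (∀ m, Measurable (Z m)) → iIndepFun Z P → (∀ m, HasLaw (Z m) M.dist P) →
        1 - ρ ≤ P.real {ω |
          (∃ What, PairwiseLearning.IsOutput lam (fun m => Z m ω) What) ∧
          ∀ What, PairwiseLearning.IsOutput lam (fun m => Z m ω) What →
            ∀ i j, i ≠ j → ∀ a b, |M.W i j a b - What i j a b| ≤ ε} := by
  -- `1536 = 16² * 6`: the squared factor `16` of the deviation times the `6` in `T = 6 L`; `64000`
  -- is the constant of the error analysis.
  refine ⟨1536 * 64000 ^ 2, by norm_num, ?_⟩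
  intro n k _ M lam hl ρ ε hρ hρ1 hε N hN Ω _ P _ Z hZ hI hL
  have hl0 : 0 ≤ lam := M.width_nonneg.trans hl
  have hk : 1 ≤ (k : ℝ) := by exact_mod_cast NeZero.pos k
  set Good : Set Ω := {ω |
          (∃ What, PairwiseLearning.IsOutput lam (fun m => Z m ω) What) ∧
          ∀ What, PairwiseLearning.IsOutput lam (fun m => Z m ω) What →
            ∀ i j, i ≠ j → ∀ a b, |M.W i j a b - What i j a b| ≤ ε} with hGood
  -- For `n < 2` there are no pairs, so the value of the logarithm at `n = 0` plays no role. For `ε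
  -- ≥ 6λ√k` the norm constraint alone suffices.
  by_cases htriv : n < 2 ∨ 6 * lam * Real.sqrt k ≤ ε
  · have : Good = Set.univ := by
      refine Set.eq_univ_of_forall fun ω => ⟨exists_isOutput hl0 _, fun What hW i j hij a b => ?_⟩
      rcases htriv with hn | hlarge
      · exact absurd (Fin.ext (by omega)) hij
      · exact hW.abs_sub_le M hε hij.symm (fun α β b w _ hw =>
          (abs_center_sub_le_of_feasible M hl hij.symm α β b hw.1).trans hlarge) a b
    rw [this, probReal_univ]
    linarith
  push Not at htriv
  obtain ⟨hn, hεl⟩ := htriv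
  have hn2 : 2 ≤ (n : ℝ) := by exact_mod_cast hn
  have hlam : 0 < lam := by
    rcases hl0.eq_or_lt with h | h
    · rw [← h] at hεl; simp at hεl; linarith
    · exact h
  have hL0 : 0 < Real.log ((n : ℝ) * k / ρ) := by
    apply Real.log_pos
    rw [lt_div_iff₀ hρ]
    nlinarith
  set L := Real.log ((n : ℝ) * k / ρ) with hLdef
  have hN0 : 0 < (N : ℝ) := lt_of_lt_of_le (by positivity) hN
  set δ := 16 * lam * Real.sqrt k * Real.sqrt (6 * L / N) with hδdef
  have hδ : 0 ≤ δ := by positivity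
  have hδε : 64000 * (δ * (k * Real.sqrt k * Real.exp (7 * lam))) ≤ ε ^ 2 :=
    deviation_le_of_sample_size (by linarith) hL0.le hε hN0 hN
  set A : Fin n × Fin k × Fin k → Set Ω := fun p => {ω | p.2.1 ≠ p.2.2 ∧
    RiskViolation M p.1 p.2.1 (fun x => x p.1 = p.2.1 ∨ x p.1 = p.2.2) lam
      (δ * Real.sqrt (∑ x with (x p.1 = p.2.1 ∨ x p.1 = p.2.2), M.mass x))
      (fun m => Z m ω)} with hA
  set B : (Fin n × Fin k × Fin k) × (Fin n × Fin k) → Set Ω := fun p =>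
    {ω | (p.1.2.1 ≠ p.1.2.2 ∧ p.2.1 ≠ p.1.1) ∧
    RiskViolation M p.1.1 p.1.2.1
      (fun x => (x p.1.1 = p.1.2.1 ∨ x p.1.1 = p.1.2.2) ∧ x p.2.1 = p.2.2) lam
      (δ * Real.sqrt
        (∑ x with ((x p.1.1 = p.1.2.1 ∨ x p.1.1 = p.1.2.2) ∧ x p.2.1 = p.2.2), M.mass x))
      (fun m => Z m ω)} with hB
  have hm : ∀ (S : Finset (Fin n → Fin k)), 0 ≤ ∑ x ∈ S, M.mass x :=
    fun S => Finset.sum_nonneg fun x _ => (M.mass_pos x).le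
  have hPA : ∀ p, P.real (A p) ≤ 4 * n * Real.exp (-(6 * L)) := by
    rintro ⟨i, α, β⟩
    by_cases h : α ≠ β
    · simp only [hA, h, ne_eq, not_false_eq_true, true_and]
      -- A second variable exists since `n ≥ 2`; the pair event inherits the lower bound of its
      -- sub-event `z j = 0`.
      obtain ⟨j, hj⟩ : ∃ j : Fin n, j ≠ i := by
        have : Nontrivial (Fin n) := Fin.nontrivial_iff_two_le.2 hn
        exact exists_ne i
      refine measureReal_riskViolation_le M P Z hZ hI hL i α _ hlam (by positivity) ?_
      refine le_mul_of_sample_size hlam hk hL0.le hε hεl.le hN0.le (hm _) ?_ hN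
      refine (one_le_mul_sum_pair_and M hl hj h 0).trans ?_
      exact mul_le_mul_of_nonneg_left (sum_pair_and_le M i j α β 0) (by positivity)
    · simp only [hA, h, false_and, Set.ofPred_false, measureReal_empty]
      positivity
  have hPB : ∀ p, P.real (B p) ≤ 4 * n * Real.exp (-(6 * L)) := by
    rintro ⟨⟨i, α, β⟩, j, b⟩
    by_cases h : α ≠ β ∧ j ≠ i
    · simp only [hB, h, ne_eq, not_false_eq_true, true_and]
      refine measureReal_riskViolation_le M P Z hZ hI hL i α _ hlam (by positivity) ?_
      exact le_mul_of_sample_size hlam hk hL0.le hε hεl.le hN0.le (hm _)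
        (one_le_mul_sum_pair_and M hl h.2 h.1 b) hN
    · simp only [hB, h, false_and, Set.ofPred_false, measureReal_empty]
      positivity
  -- Only monotonicity and subadditivity are applied to this cover, so measurability of `Good` is
  -- not needed.
  have hcover : Set.univ ⊆ Good ∪ ((⋃ p, A p) ∪ ⋃ p, B p) := by
    intro ω _
    by_contra hcon
    simp only [Set.mem_union, Set.mem_iUnion, not_or, not_exists] at hcon
    obtain ⟨hG, hcA, hcB⟩ := hcon
    refine hG ⟨exists_isOutput hl0 _, fun What hW i j hij a b => ?_⟩
    refine hW.abs_sub_le M hε hij.symm (fun α β b w h hw => ?_) a b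
    exact abs_center_sub_le_of_not_riskViolation M hl hij.symm h hδ hε hδε
      (fun hv => hcA (i, α, β) ⟨h, hv⟩) (fun hv => hcB ((i, α, β), (j, b)) ⟨⟨h, hij.symm⟩, hv⟩) hw
  have h1 : P.real (⋃ p, A p) ≤ n * k * k * (4 * n * Real.exp (-(6 * L))) := by
    refine (measureReal_iUnion_fintype_le _).trans ((Finset.sum_le_sum fun p _ => hPA p).trans ?_)
    simp only [Finset.sum_const, Finset.card_univ, Fintype.card_prod, Fintype.card_fin,
      nsmul_eq_mul]
    push_cast
    exact le_of_eq (by ring)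
  have h2 : P.real (⋃ p, B p) ≤ n * k * k * (n * k) * (4 * n * Real.exp (-(6 * L))) := by
    refine (measureReal_iUnion_fintype_le _).trans ((Finset.sum_le_sum fun p _ => hPB p).trans ?_)
    simp only [Finset.sum_const, Finset.card_univ, Fintype.card_prod, Fintype.card_fin,
      nsmul_eq_mul]
    push_cast
    exact le_of_eq (by ring)
  have h3 := measureReal_mono (μ := P) hcover
  rw [probReal_univ] at h3
  have h4 := measureReal_union_le (μ := P) Good ((⋃ p, A p) ∪ ⋃ p, B p)
  have h5 := measureReal_union_le (μ := P) (⋃ p, A p) (⋃ p, B p)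
  have h6 := union_bound_le (k := k) hn2 hk hρ hρ1
  linarith
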